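/- Let $g \ge 1$, $n = 2g+2$, and let $f(x,y) = f_0x^n + f_1x^{n-1}y + \dots + f_ny^n \in \mathbb{Z}[x,y]$ be a binary form of nonzero discriminant with $f_0 f_n \ne 0$. Let $X$ be the hyperelliptic curve $z^2 = f(x,y)$ over $\mathbb{Q}$, $\iota : z \mapsto -z$ its involution, $\pi : X \to \mathbb{P}^1$ the double cover, and $j : S_f \hookrightarrow X$ the locus $z = 0$, identified with the zero locus of $f$ in $\mathbb{P}^1$. Let $D$ be an effective $\mathbb{Q}$-rational divisor of degree $2g-1$ on $X$ whose support is disjoint from $S_f$, and let $U \in \mathbb{Z}[x,y]$ be a primitive form of degree $2g-1$ vanishing precisely at the points of $\pi(D)$, with multiplicity. Let $M_{\mathbb{Q}} = H^0(S_f, j^*\mathcal{O}_X(D))$, let $\bar 1 \in M_{\mathbb{Q}}$ be the restriction of the tautological section $1$ of $\mathcal{O}_X(D)$, and let $\varphi : M_{\mathbb{Q}} \times M_{\mathbb{Q}} \to I_f = H^0(S_f, \mathcal{O}(n-3))$ be the symmetric pairing induced by the map $\mathcal{O}_X(D) \otimes \mathcal{O}_X(\iota^*D) \to \mathcal{O}_X(2g-1)$,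 $a \otimes b \mapsto abU$, and the identity $\iota \circ j = j$. For a linear form $a \in \{x, y\}$ let $\mathrm{ev}_a : I_f \to \mathbb{Q}$ be the composite of the boundary map $I_f \to H^1(\mathbb{P}^1, \mathcal{O}(-3))$ of the sequence $0 \to \mathcal{O}(-3) \xrightarrow{f} \mathcal{O}(n-3) \to \mathcal{O}_{S_f}(n-3) \to 0$, multiplication by $a$, and the isomorphism $H^1(\mathbb{P}^1, \mathcal{O}(-2)) \cong \mathbb{Q}$ that sends the Čech class of $(xy)^{-1}$ to $1$. For a finite-dimensional real vector space $V$ with two symmetric bilinear forms $(-,-)_1, (-,-)_2$ that are simultaneously diagonalised by a basis $b_1, \dots, b_n$ of $V \otimes \mathbb{C}$, unique up to order and scaling, the reduction covariant $H$ is the restriction to $V$ of the Hermitian form on $V \otimes \mathbb{C}$ for which $b_1, \dots, b_n$ is orthogonal and $(b_i,b_i)_H = \max(|(b_i,b_i)_1|, |(b_i,b_i)_2|)$. Let $\omega_1, \dots, \omega_n \in \mathbb{C}$ be the roots of $f(X,1)$, and write $f_x, f_y$ for the partial derivatives of $f$. Then the reduction covariant $H$ of $M_{\mathbb{Q}} \otimes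 \mathbb{R}$, equipped with the forms $\mathrm{ev}_y \circ \varphi$ and $\mathrm{ev}_x \circ \varphi$, satisfies $$(\bar 1, \bar 1)_H = \sum_{|\omega_i| \le 1} \frac{|U(\omega_i,1)|}{|f_x(\omega_i,1)|} + \sum_{|\omega_i| > 1} \frac{|U(1,\omega_i^{-1})|}{|f_y(1,\omega_i^{-1})|}.$$ In particular, if $b_1, \dots, b_n$ is any $\mathbb{Q}$-basis of $M_{\mathbb{Q}}$ in which $\mathrm{ev}_y\circ\varphi$ and $\mathrm{ev}_x\circ\varphi$ have integral Gram matrices $A$ and $B$ with $(-1)^{n(n-1)/2}\det(Ax - By) = f(x,y)$, and $\bar 1 = \sum_i w_i b_i$ with $w \in \mathbb{Z}^n$, then $(w,w)_{H_{A,B}}$ equals the same sum, where $H_{A,B}$ is the reduction covariant of $\mathbb{R}^n$ with the forms given by $A$ and $B$. -/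

import Mathlib

open scoped TensorProduct Polynomial LaurentPolynomial

noncomputable section

namespace HyperellipticReduction

/-! ### Binary forms -/

/-- The dehomogenisation `f(X, 1)` of an integral form `f(x, y)`, with coefficients in `K`.
The variables `x`, `y` have indices `0`, `1`. -/
def dehom (K : Type*) [Field K] (f : MvPolynomial (Fin 2) ℤ) : K[X] :=
  MvPolynomial.aeval ![Polynomial.X, 1] f

/-- The discriminant of a binary form of degree `n` is nonzero: over `ℂ` the form is
`∏ (αᵢ x - βᵢ y)`, and its discriminant is `∏_{i < j} (αᵢ βⱼ - αⱼ βᵢ)²`. -/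
def HasNonzeroDiscriminant (n : ℕ) (f : MvPolynomial (Fin 2) ℤ) : Prop :=
  ∃ α β : Fin n → ℂ,
    MvPolynomial.map (Int.castRingHom ℂ) f =
      ∏ i, (MvPolynomial.C (α i) * MvPolynomial.X 0 - MvPolynomial.C (β i) * MvPolynomial.X 1) ∧
    ∏ i, ∏ j ∈ Finset.Ioi i, (α i * β j - α j * β i) ^ 2 ≠ 0

/-- The standing assumptions on `f = f₀ xⁿ + ⋯ + fₙ yⁿ ∈ ℤ[x, y]`, where `n = 2g + 2`:
nonzero discriminant and `f₀ fₙ ≠ 0`. -/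
structure IsCurveForm (g : ℕ) (f : MvPolynomial (Fin 2) ℤ) : Prop where
  homogeneous : f.IsHomogeneous (2 * g + 2)
  discriminant : HasNonzeroDiscriminant (2 * g + 2) f
  f_zero_ne : MvPolynomial.eval ![1, 0] f ≠ 0
  f_last_ne : MvPolynomial.eval ![0, 1] f ≠ 0

lemma dehom_map {K L : Type*} [Field K] [Field L] (φ : K →+* L) (f : MvPolynomial (Fin 2) ℤ) :
    (dehom K f).map φ = dehom L f := by
  unfold dehom
  have h : ∀ F : MvPolynomial (Fin 2) ℤ,
      ((Polynomial.mapRingHom φ).comp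
        (MvPolynomial.aeval ![(Polynomial.X : K[X]), 1]).toRingHom) F =
      (MvPolynomial.aeval ![(Polynomial.X : L[X]), 1]).toRingHom F := by
    intro F
    congr 1
    apply MvPolynomial.ringHom_ext
    · intro r; simp
    · intro i; fin_cases i <;> simp
  simpa using h f

lemma dehom_eq_sum (K : Type*) [Field K] (f : MvPolynomial (Fin 2) ℤ) :
    dehom K f = ∑ e ∈ f.support, Polynomial.C ((f.coeff e : ℤ) : K) * Polynomial.X ^ (e 0) := by
  unfold dehom
  rw [MvPolynomial.aeval_def, MvPolynomial.eval₂_eq']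
  refine Finset.sum_congr rfl fun e _ => ?_
  simp

lemma natDegree_dehom {g : ℕ} {f : MvPolynomial (Fin 2) ℤ} (hf : IsCurveForm g f) :
    (dehom ℚ f).natDegree = 2 * g + 2 := by
  have hdeg : ∀ e ∈ f.support, e 0 + e 1 = 2 * g + 2 := by
    intro e he
    have := hf.homogeneous (MvPolynomial.mem_support_iff.mp he)
    simpa [Finsupp.weight_apply, Finsupp.sum_fintype] using this
  apply Polynomial.natDegree_eq_of_le_of_coeff_ne_zero
  · rw [dehom_eq_sum]
    refine Polynomial.natDegree_sum_le_of_forall_le _ _ fun e he => ?_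
    refine (Polynomial.natDegree_C_mul_X_pow_le _ _).trans ?_
    have := hdeg e he
    omega
  · have h0 := hf.f_zero_ne
    rw [MvPolynomial.eval_eq'] at h0
    rw [dehom_eq_sum, Polynomial.finsetSum_coeff]
    intro h
    apply h0
    have : ((∑ e ∈ f.support, f.coeff e * ∏ i, (![1, 0] : Fin 2 → ℤ) i ^ e i : ℤ) : ℚ) = 0 := by
      rw [← h]
      push_cast
      refine Finset.sum_congr rfl fun e he => ?_
      have := hdeg e he
      rw [Polynomial.coeff_C_mul, Polynomial.coeff_X_pow]
      by_cases h1 : e 1 = 0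
      · have h2 : 2 * g + 2 = e 0 := by omega
        simp [h1, h2]
      · have h2 : 2 * g + 2 ≠ e 0 := by omega
        simp [h1, h2]
    exact_mod_cast this

/-! ### The curve `z² = f(x, y)` and divisors on it -/

/-- The map `R[z]/(z² - a) → S[z]/(z² - a')` induced by a ring map sending `a` to `a'`. -/
def quadMap {R S : Type*} [CommRing R] [CommRing S] (φ : R →+* S) (a : R) (a' : S)
    (h : φ a = a') : QuadraticAlgebra R a 0 →+* QuadraticAlgebra S a' 0 where
  toFun u := ⟨φ u.re, φ u.im⟩
  map_zero' := by ext <;> simp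
  map_one' := by ext <;> simp [QuadraticAlgebra.re_one, QuadraticAlgebra.im_one]
  map_add' u v := by ext <;> simp
  map_mul' u v := by subst h; ext <;> simp

/-- The coordinate ring `K[X, Z]/(Z² - f(X, 1))` of the chart `y ≠ 0` of the curve
`z² = f(x, y)`; the element `⟨p, q⟩` is `p + q Z`. -/
abbrev CoordRing (K : Type*) [Field K] (f : MvPolynomial (Fin 2) ℤ) : Type _ :=
  QuadraticAlgebra K[X] (dehom K f) 0

/-- The function field `K(X)[Z]/(Z² - f(X, 1))` of the curve `z² = f(x, y)`. -/
def FunField (K : Type*) [Field K] (f : MvPolynomial (Fin 2) ℤ) : Type _ :=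
  QuadraticAlgebra (RatFunc K) (algebraMap K[X] (RatFunc K) (dehom K f)) 0

instance (K : Type*) [Field K] (f : MvPolynomial (Fin 2) ℤ) : CommRing (FunField K f) :=
  inferInstanceAs (CommRing (QuadraticAlgebra (RatFunc K) _ 0))

/-- The conjugation `p + q Z ↦ p - q Z`, i.e. the pullback by the involution `ι : z ↦ -z`. -/
instance (K : Type*) [Field K] (f : MvPolynomial (Fin 2) ℤ) : StarRing (FunField K f) :=
  inferInstanceAs (StarRing (QuadraticAlgebra (RatFunc K) _ 0))

/-- The inclusion of the coordinate ring in the function field. -/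
def coordToFun (K : Type*) [Field K] (f : MvPolynomial (Fin 2) ℤ) :
    CoordRing K f →+* FunField K f :=
  quadMap (algebraMap K[X] (RatFunc K)) _ _ rfl

instance (K : Type*) [Field K] (f : MvPolynomial (Fin 2) ℤ) : Algebra K (FunField K f) :=
  ((coordToFun K f).comp (algebraMap K (CoordRing K f))).toAlgebra

lemma smul_eq_coord_mul {K : Type*} [Field K] {f : MvPolynomial (Fin 2) ℤ} (a : K)
    (h : FunField K f) : a • h = coordToFun K f (algebraMap K (CoordRing K f) a) * h :=
  rfl

lemma coordToFun_injective (K : Type*) [Field K] (f : MvPolynomial (Fin 2) ℤ) :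
    Function.Injective (coordToFun K f) := by
  intro u v huv
  have hi := RatFunc.algebraMap_injective K
  have h1 := congrArg QuadraticAlgebra.re huv
  have h2 := congrArg QuadraticAlgebra.im huv
  exact QuadraticAlgebra.ext (hi h1) (hi h2)

/-- The algebraic closure of `ℚ`. -/
abbrev Qbar : Type := AlgebraicClosure ℚ

lemma nonZeroDivisors_le_comap :
    nonZeroDivisors ℚ[X] ≤
      (nonZeroDivisors Qbar[X]).comap (Polynomial.mapRingHom (algebraMap ℚ Qbar)) :=
  nonZeroDivisors_le_comap_nonZeroDivisors_of_injective _
    (Polynomial.map_injective _ (algebraMap ℚ Qbar).injective)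

/-- The inclusion `ℚ(X) → ℚ̄(X)`. -/
def ratFuncToBar : RatFunc ℚ →+* RatFunc Qbar :=
  RatFunc.mapRingHom (Polynomial.mapRingHom (algebraMap ℚ Qbar)) nonZeroDivisors_le_comap

lemma ratFuncToBar_algebraMap (p : ℚ[X]) :
    ratFuncToBar (algebraMap ℚ[X] (RatFunc ℚ) p) =
      algebraMap Qbar[X] (RatFunc Qbar) (p.map (algebraMap ℚ Qbar)) := by
  have := RatFunc.map_apply_div_ne_zero (K := ℚ) (R := Qbar)
    (Polynomial.mapRingHom (algebraMap ℚ Qbar)) nonZeroDivisors_le_comap p 1 one_ne_zero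
  simpa [ratFuncToBar, RatFunc.coe_mapRingHom_eq_coe_map] using this

/-- The inclusion of the function field over `ℚ` in the function field over `ℚ̄`. -/
def funFieldToBar (f : MvPolynomial (Fin 2) ℤ) : FunField ℚ f →+* FunField Qbar f :=
  quadMap ratFuncToBar _ _ (by rw [ratFuncToBar_algebraMap, dehom_map])

/-- The inclusion of the coordinate ring over `ℚ` in the coordinate ring over `ℚ̄`. -/
def coordToBar (f : MvPolynomial (Fin 2) ℤ) : CoordRing ℚ f →+* CoordRing Qbar f :=
  quadMap (Polynomial.mapRingHom (algebraMap ℚ Qbar)) _ _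
    (by rw [Polynomial.coe_mapRingHom, dehom_map])

lemma funFieldToBar_coordToFun (f : MvPolynomial (Fin 2) ℤ) (c : CoordRing ℚ f) :
    funFieldToBar f (coordToFun ℚ f c) = coordToFun Qbar f (coordToBar f c) := by
  apply QuadraticAlgebra.ext
  · exact ratFuncToBar_algebraMap _
  · exact ratFuncToBar_algebraMap _

/-- An effective divisor of degree `d`, defined over `ℚ`, on the curve `X : z² = f(x, y)`: a
Galois-stable multiset of `d` points of `X(ℚ̄)`, namely the points `(a : 1 : b)` with
`(a, b) ∈ aff` and the points `(1 : 0 : b)` with `b ∈ inf`. -/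
structure EffectiveDivisor (f : MvPolynomial (Fin 2) ℤ) (d : ℕ) where
  aff : Multiset (Qbar × Qbar)
  inf : Multiset Qbar
  aff_mem : ∀ P ∈ aff, P.2 ^ 2 = MvPolynomial.aeval ![P.1, 1] f
  inf_mem : ∀ b ∈ inf, b ^ 2 = MvPolynomial.aeval ![(1 : Qbar), 0] f
  aff_galois : ∀ σ : Qbar ≃ₐ[ℚ] Qbar, aff.map (Prod.map σ σ) = aff
  inf_galois : ∀ σ : Qbar ≃ₐ[ℚ] Qbar, inf.map σ = inf
  degree : aff.card + inf.card = d

variable {f : MvPolynomial (Fin 2) ℤ} {d : ℕ}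

/-- The support of `D` does not meet the locus `z = 0`. -/
def EffectiveDivisor.DisjointFromBranch (D : EffectiveDivisor f d) : Prop :=
  (∀ P ∈ D.aff, P.2 ≠ 0) ∧ ∀ b ∈ D.inf, b ≠ 0

/-- The maximal ideal of the point `(a : 1 : b)` in the coordinate ring of the chart `y ≠ 0`. -/
def pointIdeal {K : Type*} [Field K] (f : MvPolynomial (Fin 2) ℤ) (P : K × K) :
    Ideal (CoordRing K f) :=
  Ideal.span {⟨Polynomial.X - Polynomial.C P.1, 0⟩, ⟨-Polynomial.C P.2, 1⟩}

/-- The ideal of `D` on the chart `y ≠ 0`, over `ℚ̄`. -/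
def EffectiveDivisor.ideal (D : EffectiveDivisor f d) : Ideal (CoordRing Qbar f) :=
  (D.aff.map (pointIdeal f)).prod

/-- `U` is a primitive integral form of degree `d` vanishing precisely at the images in `ℙ¹` of
the points of `D`, with multiplicity. -/
structure IsEquationOf (U : MvPolynomial (Fin 2) ℤ) (D : EffectiveDivisor f d) : Prop where
  homogeneous : U.IsHomogeneous d
  primitive : ∀ m : ℤ, MvPolynomial.C m ∣ U → IsUnit m
  vanishing : ∃ c : Qbar, c ≠ 0 ∧ MvPolynomial.map (Int.castRingHom Qbar) U =
    MvPolynomial.C c *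
      (D.aff.map fun P => MvPolynomial.X 0 - MvPolynomial.C P.1 * MvPolynomial.X 1).prod *
      MvPolynomial.X 1 ^ D.inf.card

/-! ### The module `H⁰(S_f, j^* 𝒪_X(D))` -/

/-- Sections of `𝒪_X(D)` over the chart `y ≠ 0`: the rational functions `h` on `X` (over `ℚ`)
with `div h + D ≥ 0` on the chart, i.e. those which multiply the ideal of `D` into the coordinate
ring. -/
def EffectiveDivisor.sections (D : EffectiveDivisor f d) : Submodule ℚ (FunField ℚ f) where
  carrier := {h | ∀ t ∈ D.ideal, ∃ c : CoordRing Qbar f,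
    coordToFun Qbar f c = funFieldToBar f h * coordToFun Qbar f t}
  zero_mem' t _ := ⟨0, by simp⟩
  add_mem' {h k} hh hk t ht := by
    obtain ⟨c, hc⟩ := hh t ht
    obtain ⟨e, he⟩ := hk t ht
    exact ⟨c + e, by rw [map_add, map_add, hc, he, add_mul]⟩
  smul_mem' a h hh t ht := by
    obtain ⟨c, hc⟩ := hh t ht
    refine ⟨coordToBar f (algebraMap ℚ (CoordRing ℚ f) a) * c, ?_⟩
    rw [smul_eq_coord_mul, map_mul (coordToFun Qbar f), map_mul (funFieldToBar f),
      funFieldToBar_coordToFun, hc, mul_assoc]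

/-- The function `Z` on the curve. -/
def zFun (f : MvPolynomial (Fin 2) ℤ) : FunField ℚ f := ⟨0, 1⟩

/-- The sections of the form `Z · h` with `h` a section. -/
def EffectiveDivisor.zSections (D : EffectiveDivisor f d) : Submodule ℚ D.sections :=
  (D.sections.map (LinearMap.mulLeft ℚ (zFun f))).comap D.sections.subtype

/-- The space `M_ℚ = H⁰(S_f, j^* 𝒪_X(D))`, where `j : S_f → X` is the locus `z = 0`. When
`f₀ ≠ 0` the scheme `S_f` lies in the chart `y ≠ 0`, where it is cut out by `Z`, so the space is
the quotient of the module of sections by `Z` times itself. -/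
abbrev EffectiveDivisor.Fibre (D : EffectiveDivisor f d) : Type :=
  D.sections ⧸ D.zSections

lemma EffectiveDivisor.one_mem_sections (D : EffectiveDivisor f d) :
    (1 : FunField ℚ f) ∈ D.sections :=
  fun t _ => ⟨t, by simp⟩

/-- The vector `1̄ ∈ M_ℚ`, the restriction to `S_f` of the tautological section `1`. -/
def EffectiveDivisor.oneBar (D : EffectiveDivisor f d) : D.Fibre :=
  Submodule.Quotient.mk ⟨1, D.one_mem_sections⟩

/-- The algebra `L_f = H⁰(S_f, 𝒪) = ℚ[X]/(f(X, 1))`. -/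
abbrev Lf (f : MvPolynomial (Fin 2) ℤ) : Type := AdjoinRoot (dehom ℚ f)

/-- Restriction to the locus `Z = 0`. -/
def restrict (f : MvPolynomial (Fin 2) ℤ) : CoordRing ℚ f →ₗ[ℚ] Lf f where
  toFun c := AdjoinRoot.mk (dehom ℚ f) c.re
  map_add' c e := by simp
  map_smul' a c := by simp [AdjoinRoot.smul_mk]

/-- The regular function `U(X, 1)` on the chart `y ≠ 0`. -/
def equationFun (f U : MvPolynomial (Fin 2) ℤ) : CoordRing ℚ f := ⟨dehom ℚ U, 0⟩

lemma coordToFun_star {K : Type*} [Field K] (c : CoordRing K f) :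
    coordToFun K f (star c) = star (coordToFun K f c) := by
  apply QuadraticAlgebra.ext
  · change algebraMap K[X] (RatFunc K) (c.re + 0 * c.im) =
      algebraMap K[X] (RatFunc K) c.re + 0 * algebraMap K[X] (RatFunc K) c.im
    simp
  · exact map_neg (algebraMap K[X] (RatFunc K)) c.im

lemma funFieldToBar_star (h : FunField ℚ f) :
    funFieldToBar f (star h) = star (funFieldToBar f h) := by
  apply QuadraticAlgebra.ext
  · change ratFuncToBar (QuadraticAlgebra.re h + 0 * QuadraticAlgebra.im h) =
      ratFuncToBar (QuadraticAlgebra.re h) + 0 * ratFuncToBar (QuadraticAlgebra.im h)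
    simp
  · exact map_neg ratFuncToBar _

lemma exists_poly_of_bar (r : RatFunc ℚ) (p : Qbar[X])
    (h : ratFuncToBar r = algebraMap Qbar[X] (RatFunc Qbar) p) :
    ∃ q : ℚ[X], algebraMap ℚ[X] (RatFunc ℚ) q = r := by
  have hd : algebraMap ℚ[X] (RatFunc ℚ) r.denom ≠ 0 := by
    simpa using r.denom_ne_zero
  have h1 : r * algebraMap ℚ[X] (RatFunc ℚ) r.denom = algebraMap ℚ[X] (RatFunc ℚ) r.num := by
    rw [← eq_div_iff hd, RatFunc.num_div_denom]
  have h2 := congrArg ratFuncToBar h1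
  rw [map_mul, ratFuncToBar_algebraMap, ratFuncToBar_algebraMap, h, ← map_mul] at h2
  have h3 := RatFunc.algebraMap_injective _ h2
  have h4 : r.denom ∣ r.num := by
    rw [← Polynomial.map_dvd_map' (algebraMap ℚ Qbar)]
    exact ⟨p, by rw [← h3, mul_comm]⟩
  obtain ⟨q, hq⟩ := h4
  refine ⟨q, ?_⟩
  rw [hq, map_mul] at h1
  exact (mul_right_cancel₀ hd (h1.trans (mul_comm _ _))).symm

lemma exists_coord_of_bar (h : FunField ℚ f) (c : CoordRing Qbar f)
    (hc : coordToFun Qbar f c = funFieldToBar f h) :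
    ∃ e : CoordRing ℚ f, coordToFun ℚ f e = h := by
  obtain ⟨p, hp⟩ := exists_poly_of_bar (QuadraticAlgebra.re h) c.re
    (congrArg QuadraticAlgebra.re hc).symm
  obtain ⟨q, hq⟩ := exists_poly_of_bar (QuadraticAlgebra.im h) c.im
    (congrArg QuadraticAlgebra.im hc).symm
  exact ⟨⟨p, q⟩, QuadraticAlgebra.ext hp hq⟩

/-- The conjugate under `Z ↦ -Z` of an ideal of the coordinate ring. -/
def conjIdeal {K : Type*} [Field K] (I : Ideal (CoordRing K f)) : Ideal (CoordRing K f) :=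
  I.comap (starRingEnd (CoordRing K f))

lemma exists_inv_two_mul {K : Type*} [Field K] [CharZero K] {b : K} (hb : b ≠ 0) :
    ∃ e : K[X], e * (2 * Polynomial.C b) = 1 :=
  ⟨Polynomial.C (2 * b)⁻¹, by
    rw [← Polynomial.C_ofNat, ← Polynomial.C_mul, ← Polynomial.C_mul,
      inv_mul_cancel₀ (by simpa using hb), Polynomial.C_1]⟩

lemma quad_identity {R : Type*} [CommRing R] {a x b e : R} (he : e * (2 * b) = 1) :
    (⟨x, 0⟩ : QuadraticAlgebra R a 0) =
      ⟨-e, 0⟩ * (⟨x, 0⟩ * star ⟨-b, 1⟩ + ⟨-b, 1⟩ * ⟨x, 0⟩) := by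
  ext1
  · simp
    linear_combination -x * he
  · simp

lemma sub_mem_mul_conj {K : Type*} [Field K] [CharZero K] (P : K × K) (hP : P.2 ≠ 0) :
    (⟨Polynomial.X - Polynomial.C P.1, 0⟩ : CoordRing K f) ∈
      pointIdeal f P * conjIdeal (pointIdeal f P) := by
  obtain ⟨e, he⟩ := exists_inv_two_mul hP
  have hu1 : (⟨Polynomial.X - Polynomial.C P.1, 0⟩ : CoordRing K f) ∈ pointIdeal f P :=
    Ideal.subset_span (Set.mem_insert _ _)
  have hv1 : (⟨-Polynomial.C P.2, 1⟩ : CoordRing K f) ∈ pointIdeal f P :=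
    Ideal.subset_span (Set.mem_insert_of_mem _ rfl)
  generalize hI : pointIdeal f P = I at *
  generalize Polynomial.X - Polynomial.C P.1 = x at *
  generalize Polynomial.C P.2 = b at *
  have hu2 : (⟨x, 0⟩ : CoordRing K f) ∈ conjIdeal I := by
    have hsu : star (⟨x, 0⟩ : CoordRing K f) = ⟨x, 0⟩ := by ext1 <;> simp
    change star (⟨x, 0⟩ : CoordRing K f) ∈ I
    rwa [hsu]
  have hv2 : star (⟨-b, 1⟩ : CoordRing K f) ∈ conjIdeal I := by
    change star (star (⟨-b, 1⟩ : CoordRing K f)) ∈ I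
    rwa [star_star]
  have h := Ideal.mul_mem_left _ (⟨-e, 0⟩ : CoordRing K f)
    (add_mem (Ideal.mul_mem_mul hu1 hv2) (Ideal.mul_mem_mul hv1 hu2))
  rwa [← quad_identity he] at h

lemma mk_zero_mul_mk_zero {R : Type*} [CommRing R] {a : R} (x y : R) :
    (⟨x, 0⟩ : QuadraticAlgebra R a 0) * ⟨y, 0⟩ = ⟨x * y, 0⟩ := by
  ext1 <;> simp

lemma prod_mem_mul_conj {K : Type*} [Field K] [CharZero K] (S : Multiset (K × K)) (hS : ∀ P ∈ S, P.2 ≠ 0) :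
    (⟨(S.map fun P => Polynomial.X - Polynomial.C P.1).prod, 0⟩ : CoordRing K f) ∈
      (S.map (pointIdeal f)).prod * conjIdeal (S.map (pointIdeal f)).prod := by
  induction S using Multiset.induction_on with
  | empty =>
    have h1 : conjIdeal (1 : Ideal (CoordRing K f)) = 1 := by
      simp [conjIdeal, Ideal.one_eq_top]
    rw [Multiset.map_zero, Multiset.prod_zero, Multiset.map_zero, Multiset.prod_zero, h1]
    simp [Ideal.one_eq_top]
  | cons P S ih =>
    have h1 := ih fun Q hQ => hS Q (Multiset.mem_cons_of_mem hQ)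
    have h2 := sub_mem_mul_conj (f := f) P (hS P (Multiset.mem_cons_self P S))
    have h3 := Ideal.mul_mem_mul h2 h1
    rw [mul_mul_mul_comm] at h3
    rw [Multiset.map_cons, Multiset.map_cons, Multiset.prod_cons, Multiset.prod_cons]
    have h4 := Ideal.mul_mono_right (I := pointIdeal f P * (S.map (pointIdeal f)).prod)
      (Ideal.le_comap_mul (starRingEnd (CoordRing K f)) (K := pointIdeal f P)
        (L := (S.map (pointIdeal f)).prod))
    rw [mk_zero_mul_mk_zero] at h3
    exact h4 h3

lemma dehom_bar_equation {U : MvPolynomial (Fin 2) ℤ} {D : EffectiveDivisor f d}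
    (hU : IsEquationOf U D) : ∃ c : Qbar, dehom Qbar U =
      Polynomial.C c * (D.aff.map fun P => Polynomial.X - Polynomial.C P.1).prod := by
  obtain ⟨c, -, hc⟩ := hU.vanishing
  refine ⟨c, ?_⟩
  have h := congrArg
    (MvPolynomial.eval₂Hom (Polynomial.C : Qbar →+* Qbar[X]) ![Polynomial.X, 1]) hc
  simp only [map_mul, map_pow, map_multiset_prod, Multiset.map_map] at h
  have h1 : MvPolynomial.eval₂Hom (Polynomial.C : Qbar →+* Qbar[X]) ![Polynomial.X, 1]
      (MvPolynomial.map (Int.castRingHom Qbar) U) = dehom Qbar U := by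
    rw [MvPolynomial.coe_eval₂Hom, MvPolynomial.eval₂_map, dehom, MvPolynomial.aeval_def]
    congr 1
  rw [h1] at h
  rw [h]
  simp [Function.comp_def]

/-- If `h`, `k` are sections of `𝒪_X(D)` then `h · ι(k) · U` is regular on the chart `y ≠ 0`. -/
lemma exists_pairing {U : MvPolynomial (Fin 2) ℤ} {D : EffectiveDivisor f d}
    (hD : D.DisjointFromBranch) (hU : IsEquationOf U D) {h k : FunField ℚ f}
    (hh : h ∈ D.sections) (hk : k ∈ D.sections) :
    ∃ e : CoordRing ℚ f,
      coordToFun ℚ f e = h * star k * coordToFun ℚ f (equationFun f U) := by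
  have key : ∀ w ∈ D.ideal * conjIdeal D.ideal, ∃ c : CoordRing Qbar f,
      coordToFun Qbar f c =
        funFieldToBar f h * star (funFieldToBar f k) * coordToFun Qbar f w := by
    intro w hw
    induction hw using Submodule.mul_induction_on' with
    | mem_mul_mem t ht s hs =>
      obtain ⟨c, hc⟩ := hh t ht
      obtain ⟨e, he⟩ := hk (star s) hs
      refine ⟨c * star e, ?_⟩
      rw [map_mul, hc, coordToFun_star, he, star_mul', ← coordToFun_star, star_star, map_mul]
      ring
    | add x _ y _ hx hy =>
      obtain ⟨c, hc⟩ := hx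
      obtain ⟨e, he⟩ := hy
      exact ⟨c + e, by rw [map_add, map_add, hc, he, mul_add]⟩
  obtain ⟨a, ha⟩ := dehom_bar_equation hU
  obtain ⟨c, hc⟩ := key _ (prod_mem_mul_conj D.aff hD.1)
  refine exists_coord_of_bar _ (⟨Polynomial.C a, 0⟩ * c) ?_
  rw [map_mul, hc, map_mul, map_mul, funFieldToBar_star, funFieldToBar_coordToFun]
  have : coordToBar f (equationFun f U) = ⟨Polynomial.C a, 0⟩ *
        ⟨(D.aff.map fun P => Polynomial.X - Polynomial.C P.1).prod, 0⟩ := by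
    ext1
    · change (dehom ℚ U).map _ = _
      rw [dehom_map, ha]
      simp
    · simp [coordToBar, quadMap, equationFun]
  rw [this, map_mul]
  ring

/-- The function `h · ι(k) · U` on the chart `y ≠ 0`, for sections `h`, `k` of `𝒪_X(D)`. -/
def regularProduct {U : MvPolynomial (Fin 2) ℤ} {D : EffectiveDivisor f d}
    (hD : D.DisjointFromBranch) (hU : IsEquationOf U D) (h k : D.sections) : CoordRing ℚ f :=
  (exists_pairing hD hU h.2 k.2).choose

lemma coordToFun_regularProduct {U : MvPolynomial (Fin 2) ℤ} {D : EffectiveDivisor f d}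
    (hD : D.DisjointFromBranch) (hU : IsEquationOf U D) (h k : D.sections) :
    coordToFun ℚ f (regularProduct hD hU h k) =
      (h : FunField ℚ f) * star (k : FunField ℚ f) * coordToFun ℚ f (equationFun f U) :=
  (exists_pairing hD hU h.2 k.2).choose_spec

lemma star_smul_fun (a : ℚ) (h : FunField ℚ f) : star (a • h) = a • star h := by
  rw [smul_eq_coord_mul, smul_eq_coord_mul, star_mul', ← coordToFun_star]
  congr 2
  rw [IsScalarTower.algebraMap_apply ℚ ℚ[X] (CoordRing ℚ f)]
  ext1 <;> simp

lemma coordToFun_smul (a : ℚ) (c : CoordRing ℚ f) :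
    coordToFun ℚ f (a • c) = a • coordToFun ℚ f c := by
  rw [smul_eq_coord_mul, Algebra.smul_def, map_mul]

/-- The pairing `(h, k) ↦ (h · ι(k) · U)|_{S_f}` on sections of `𝒪_X(D)`. It takes values in
`H⁰(S_f, 𝒪(n - 3)) = L_f · y^{n-3}`, which is identified with `L_f`. -/
def sectionPairing {U : MvPolynomial (Fin 2) ℤ} {D : EffectiveDivisor f d}
    (hD : D.DisjointFromBranch) (hU : IsEquationOf U D) :
    D.sections →ₗ[ℚ] D.sections →ₗ[ℚ] Lf f :=
  LinearMap.mk₂ ℚ (fun h k => restrict f (regularProduct hD hU h k))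
    (fun h h' k => by
      rw [← map_add]; congr 1; apply coordToFun_injective
      simp only [map_add, coordToFun_regularProduct, Submodule.coe_add, add_mul])
    (fun a h k => by
      rw [← map_smul]; congr 1; apply coordToFun_injective
      simp only [coordToFun_smul, coordToFun_regularProduct, Submodule.coe_smul,
        smul_mul_assoc])
    (fun h k k' => by
      rw [← map_add]; congr 1; apply coordToFun_injective
      simp only [map_add, coordToFun_regularProduct, Submodule.coe_add, star_add, add_mul,
        mul_add])
    (fun a h k => by
      rw [← map_smul]; congr 1; apply coordToFun_injective
      simp only [coordToFun_smul, coordToFun_regularProduct, Submodule.coe_smul, star_smul_fun,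
        smul_mul_assoc, mul_smul_comm])

lemma restrict_z_mul (c : CoordRing ℚ f) : restrict f (⟨0, 1⟩ * c) = 0 := by
  change AdjoinRoot.mk (dehom ℚ f) (0 * c.re + dehom ℚ f * 1 * c.im) = 0
  simp

lemma zSections_le_ker {U : MvPolynomial (Fin 2) ℤ} {D : EffectiveDivisor f d}
    (hD : D.DisjointFromBranch) (hU : IsEquationOf U D) :
    D.zSections ≤ (sectionPairing hD hU).ker := by
  rintro h ⟨h', hh', e⟩
  rw [LinearMap.mem_ker]
  ext k
  change restrict f (regularProduct hD hU h k) = 0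
  rw [← restrict_z_mul (regularProduct hD hU ⟨h', hh'⟩ k)]
  congr 1
  apply coordToFun_injective
  have e' : zFun f * h' = (h : FunField ℚ f) := e
  have hz : coordToFun ℚ f ⟨0, 1⟩ = zFun f := by
    apply QuadraticAlgebra.ext
    · exact map_zero _
    · exact map_one _
  rw [map_mul, coordToFun_regularProduct, coordToFun_regularProduct, ← e', hz]
  ring

lemma zSections_le_ker_flip {U : MvPolynomial (Fin 2) ℤ} {D : EffectiveDivisor f d}
    (hD : D.DisjointFromBranch) (hU : IsEquationOf U D) :
    D.zSections ≤ (sectionPairing hD hU).flip.ker := by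
  rintro k ⟨k', hk', e⟩
  rw [LinearMap.mem_ker]
  ext h
  change restrict f (regularProduct hD hU h k) = 0
  rw [← restrict_z_mul (-regularProduct hD hU h ⟨k', hk'⟩)]
  congr 1
  apply coordToFun_injective
  have e' : zFun f * k' = (k : FunField ℚ f) := e
  have hz : coordToFun ℚ f ⟨0, 1⟩ = zFun f := by
    apply QuadraticAlgebra.ext
    · exact map_zero _
    · exact map_one _
  have hs : star (zFun f) = -zFun f := by
    rw [← hz, ← coordToFun_star, ← map_neg]
    congr 1
    ext1 <;> simp
  rw [map_mul, map_neg, coordToFun_regularProduct, coordToFun_regularProduct, ← e', hz,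
    star_mul', hs]
  ring

/-- The pairing `φ : M_ℚ × M_ℚ → I_f = H⁰(S_f, 𝒪(n - 3)) = L_f · y^{n-3} ≅ L_f`, induced by
`𝒪_X(D) ⊗ 𝒪_X(ι^* D) ≅ 𝒪_X(2g - 1)`, `a ⊗ b ↦ a b U`, and `ι ∘ j = j`. -/
def pairing {U : MvPolynomial (Fin 2) ℤ} {D : EffectiveDivisor f d}
    (hD : D.DisjointFromBranch) (hU : IsEquationOf U D) :
    D.Fibre →ₗ[ℚ] D.Fibre →ₗ[ℚ] Lf f :=
  (sectionPairing hD hU).liftQ₂ D.zSections D.zSections (zSections_le_ker hD hU)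
    (zSections_le_ker_flip hD hU)

/-! ### The linear forms `ev_y`, `ev_x` on `I_f` -/

/-- Čech data for a section `p y^{n-3}` of `𝒪(n - 3)` on `S_f ⊂ ℙ¹`. The section is lifted to
`p(X) y^{n-3}` on `D⁺(y)` and to `q(y/x) x^{n-3}` on `D⁺(x)`, where `X = x/y`. The difference of
the two lifts on `D⁺(xy)` is `f` times `r y^{-3}`, with `r ∈ ℚ[X, X⁻¹]`, so `r y^{-3}` represents
the image of the section under the boundary map `H⁰(S_f, 𝒪(n - 3)) → H¹(ℙ¹, 𝒪(-3))` of
`0 → 𝒪(-3) → 𝒪(n - 3) → 𝒪_{S_f}(n - 3) → 0`. Here `F = f(X, 1)` and `m = n - 3`. -/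
def IsCechLift (F : ℚ[X]) (m : ℤ) (p q : ℚ[X]) (r : ℚ[T;T⁻¹]) : Prop :=
  Polynomial.toLaurent p -
    LaurentPolynomial.T m * LaurentPolynomial.invert (Polynomial.toLaurent q) =
      Polynomial.toLaurent F * r

lemma exists_invert (w : ℚ[X]) (N : ℕ) (hw : w.natDegree ≤ N) : ∃ q : ℚ[X],
    Polynomial.toLaurent w =
      LaurentPolynomial.T N * LaurentPolynomial.invert (Polynomial.toLaurent q) := by
  refine ⟨Polynomial.X ^ (N - w.natDegree) * w.reverse, ?_⟩
  rw [map_mul, LaurentPolynomial.toLaurent_reverse, map_mul, map_mul,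
    Polynomial.toLaurent_X_pow, LaurentPolynomial.invert_T, LaurentPolynomial.invert_T,
    LaurentPolynomial.involutive_invert]
  have h : (LaurentPolynomial.T (N : ℤ) * LaurentPolynomial.T (-((N - w.natDegree : ℕ) : ℤ)) *
      LaurentPolynomial.T (-(w.natDegree : ℤ)) : ℚ[T;T⁻¹]) = 1 := by
    rw [← LaurentPolynomial.T_add, ← LaurentPolynomial.T_add, ← LaurentPolynomial.T_zero]
    congr 1
    push_cast [Nat.cast_sub hw]
    ring
  linear_combination -(Polynomial.toLaurent w) * h

lemma exists_cechLift {F : ℚ[X]} {N : ℕ} (hF : F.natDegree = N + 1) (p : ℚ[X]) :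
    ∃ (q : ℚ[X]) (r : ℚ[T;T⁻¹]), IsCechLift F (N - 2) p q r := by
  have hF0 : F ≠ 0 := by
    rintro rfl
    simp at hF
  set G := Polynomial.X ^ 2 * p with hG
  have hw : (G % F).natDegree ≤ N := by
    have := Polynomial.natDegree_mod_lt G (q := F) (by omega)
    omega
  obtain ⟨q, hq⟩ := exists_invert _ N hw
  refine ⟨q, LaurentPolynomial.T (-2) * Polynomial.toLaurent (G / F), ?_⟩
  have h1 := congrArg Polynomial.toLaurent (EuclideanDomain.div_add_mod G F)
  rw [map_add, map_mul, hq, hG, map_mul, Polynomial.toLaurent_X_pow] at h1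
  have h2 : (LaurentPolynomial.T (-2) * LaurentPolynomial.T ((2 : ℕ) : ℤ) : ℚ[T;T⁻¹]) = 1 := by
    rw [← LaurentPolynomial.T_add, ← LaurentPolynomial.T_zero]
    rfl
  have h3 : (LaurentPolynomial.T ((N : ℤ) - 2) : ℚ[T;T⁻¹]) =
      LaurentPolynomial.T (-2) * LaurentPolynomial.T N := by
    rw [← LaurentPolynomial.T_add]
    congr 1
  unfold IsCechLift
  rw [h3]
  linear_combination (-Polynomial.toLaurent p) * h2 - LaurentPolynomial.T (-2) * h1

/-- The coefficients of `X⁻¹` and `X⁻²` in the Čech class depend only on `p` modulo `F`. -/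
lemma cech_unique_aux {F : ℚ[X]} {N : ℕ} (hF : F.natDegree = N + 1) {p q : ℚ[X]}
    {r : ℚ[T;T⁻¹]} (h : IsCechLift F (N - 2) p q r) (hp : F ∣ p) {k : ℤ}
    (hk : k = -1 ∨ k = -2) : r.coeff k = 0 := by
  obtain ⟨s, rfl⟩ := hp
  have hF0 : F ≠ 0 := by
    rintro rfl
    simp at hF
  set ρ := LaurentPolynomial.invert (r - Polynomial.toLaurent s) with hρ
  have h1 : Polynomial.toLaurent F.reverse * ρ =
      -(Polynomial.toLaurent (Polynomial.X ^ 3 * q)) := by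
    have h2 := congrArg LaurentPolynomial.invert h
    simp only [map_sub, map_mul, LaurentPolynomial.invert_T] at h2
    rw [LaurentPolynomial.involutive_invert] at h2
    rw [LaurentPolynomial.toLaurent_reverse, hF, map_mul, Polynomial.toLaurent_X_pow, hρ, map_sub]
    have h3 : (LaurentPolynomial.T ((N + 1 : ℕ) : ℤ) * LaurentPolynomial.T (-((N : ℤ) - 2)) :
        ℚ[T;T⁻¹]) = LaurentPolynomial.T ((3 : ℕ) : ℤ) := by
      rw [← LaurentPolynomial.T_add]
      congr 1
      push_cast
      ring
    rw [← h3]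
    linear_combination -(LaurentPolynomial.T ((N + 1 : ℕ) : ℤ)) * h2
  obtain ⟨j, σ, hσ⟩ := LaurentPolynomial.exists_T_pow ρ
  have h4 : F.reverse * σ = -(Polynomial.X ^ (j + 3) * q) := by
    apply Polynomial.toLaurent_injective
    rw [map_mul, hσ, ← mul_assoc, h1, pow_add, mul_assoc, mul_comm (Polynomial.X ^ j), map_neg,
      map_mul (Polynomial.toLaurent) (Polynomial.X ^ 3 * q), Polynomial.toLaurent_X_pow]
    ring
  have h5 : Polynomial.X ^ (j + 3) ∣ σ := by
    have hX : ¬ Polynomial.X ∣ F.reverse := by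
      rw [Polynomial.X_dvd_iff, Polynomial.coeff_zero_reverse]
      simpa using hF0
    refine Polynomial.prime_X.pow_dvd_of_dvd_mul_left _ hX ⟨-q, ?_⟩
    rw [h4]
    ring
  obtain ⟨τ, rfl⟩ := h5
  have h6 : ρ = LaurentPolynomial.T ((3 : ℕ) : ℤ) * Polynomial.toLaurent τ := by
    have h7 := congrArg (· * (LaurentPolynomial.T (-(j : ℤ)) : ℚ[T;T⁻¹])) hσ
    simp only [LaurentPolynomial.mul_T_assoc, add_neg_cancel, LaurentPolynomial.T_zero,
      mul_one] at h7
    rw [← h7, pow_add, map_mul, map_mul, Polynomial.toLaurent_X_pow, Polynomial.toLaurent_X_pow]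
    have h8 : (LaurentPolynomial.T (j : ℤ) * LaurentPolynomial.T (-(j : ℤ)) : ℚ[T;T⁻¹]) = 1 := by
      rw [← LaurentPolynomial.T_add, add_neg_cancel, LaurentPolynomial.T_zero]
    linear_combination
      (LaurentPolynomial.T ((3 : ℕ) : ℤ) * Polynomial.toLaurent τ) * h8
  have neg_coeff : ∀ (P : ℚ[X]) (l : ℤ), l < 0 → (Polynomial.toLaurent P).coeff l = 0 := by
    intro P l hl
    by_contra hne
    have := Finsupp.mem_support_iff.mpr hne
    rw [LaurentPolynomial.support_coeff_toLaurent] at this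
    obtain ⟨a, -, ha⟩ := Finset.mem_map.mp this
    simp at ha
    omega
  have nat_coeff : ∀ (P : ℚ[X]) (l : ℕ), (Polynomial.toLaurent P).coeff (l : ℤ) = P.coeff l := by
    intro P l
    rw [LaurentPolynomial.coeff_toLaurent]
    exact Finsupp.mapDomain_apply Nat.castEmbedding.injective _ l
  have h9 : ρ.coeff (-k) = 0 := by
    rw [h6, ← Polynomial.toLaurent_X_pow, ← map_mul]
    rcases hk with rfl | rfl
    · exact (nat_coeff _ 1).trans (by rw [Polynomial.coeff_X_pow_mul']; simp)
    · exact (nat_coeff _ 2).trans (by rw [Polynomial.coeff_X_pow_mul']; simp)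
  have h10 : ρ.coeff (-k) = r.coeff k - (Polynomial.toLaurent s).coeff k := by
    rw [hρ, LaurentPolynomial.invert_apply, neg_neg]
    rfl
  rw [h9, neg_coeff s k (by omega)] at h10
  linarith

lemma IsCechLift.add {F : ℚ[X]} {m : ℤ} {p q p' q' : ℚ[X]} {r r' : ℚ[T;T⁻¹]}
    (h : IsCechLift F m p q r) (h' : IsCechLift F m p' q' r') :
    IsCechLift F m (p + p') (q + q') (r + r') := by
  unfold IsCechLift at *
  simp only [map_add]
  linear_combination h + h'

lemma IsCechLift.smul {F : ℚ[X]} {m : ℤ} {p q : ℚ[X]} {r : ℚ[T;T⁻¹]} (a : ℚ)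
    (h : IsCechLift F m p q r) : IsCechLift F m (a • p) (a • q) (a • r) := by
  unfold IsCechLift at *
  simp only [Polynomial.smul_eq_C_mul, LaurentPolynomial.smul_eq_C_mul, map_mul,
    Polynomial.toLaurent_C, LaurentPolynomial.invert_C]
  linear_combination LaurentPolynomial.C a * h

lemma exists_cechLift_Lf {g : ℕ} (hf : IsCurveForm g f) (ξ : Lf f) :
    ∃ (r : ℚ[T;T⁻¹]) (p q : ℚ[X]), AdjoinRoot.mk (dehom ℚ f) p = ξ ∧
      IsCechLift (dehom ℚ f) (2 * g - 1) p q r := by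
  obtain ⟨p, rfl⟩ := AdjoinRoot.mk_surjective ξ
  obtain ⟨q, r, h⟩ := exists_cechLift (N := 2 * g + 1) (natDegree_dehom hf) p
  refine ⟨r, p, q, rfl, ?_⟩
  have : ((2 * g + 1 : ℕ) : ℤ) - 2 = 2 * g - 1 := by push_cast; ring
  rwa [this] at h

lemma cech_unique {g : ℕ} (hf : IsCurveForm g f) {p q p' q' : ℚ[X]} {r r' : ℚ[T;T⁻¹]}
    (h : IsCechLift (dehom ℚ f) (2 * g - 1) p q r)
    (h' : IsCechLift (dehom ℚ f) (2 * g - 1) p' q' r')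
    (hp : AdjoinRoot.mk (dehom ℚ f) p = AdjoinRoot.mk (dehom ℚ f) p') {k : ℤ}
    (hk : k = -1 ∨ k = -2) : r.coeff k = r'.coeff k := by
  have h1 := h.add (h'.smul (-1))
  have h2 : ((2 * g + 1 : ℕ) : ℤ) - 2 = 2 * g - 1 := by push_cast; ring
  rw [← h2] at h1
  have h3 : dehom ℚ f ∣ p + (-1 : ℚ) • p' := by
    rw [neg_one_smul, ← sub_eq_add_neg]
    exact AdjoinRoot.mk_eq_mk.mp hp
  have h4 := cech_unique_aux (natDegree_dehom hf) h1 h3 hk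
  have h5 : r.coeff k + (-1 : ℚ) * r'.coeff k = 0 := h4
  linarith

/-- The coefficient of `X^k y⁻³` in the image of a section under the boundary map
`I_f = L_f · y^{n-3} → H¹(ℙ¹, 𝒪(-3))`; here `H¹(ℙ¹, 𝒪(-3))` has basis the classes of
`X⁻¹ y⁻³ = x⁻¹ y⁻²` and `X⁻² y⁻³ = x⁻² y⁻¹`. -/
def boundaryCoeff {g : ℕ} (hf : IsCurveForm g f) (k : ℤ) (hk : k = -1 ∨ k = -2) :
    Lf f →ₗ[ℚ] ℚ where
  toFun ξ := (exists_cechLift_Lf hf ξ).choose.coeff k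
  map_add' ξ η := by
    obtain ⟨p, q, hp, h⟩ := (exists_cechLift_Lf hf ξ).choose_spec
    obtain ⟨p', q', hp', h'⟩ := (exists_cechLift_Lf hf η).choose_spec
    obtain ⟨p'', q'', hp'', h''⟩ := (exists_cechLift_Lf hf (ξ + η)).choose_spec
    exact cech_unique hf h'' (h.add h') (by rw [hp'', map_add, hp, hp']) hk
  map_smul' a ξ := by
    obtain ⟨p, q, hp, h⟩ := (exists_cechLift_Lf hf ξ).choose_spec
    obtain ⟨p'', q'', hp'', h''⟩ := (exists_cechLift_Lf hf (a • ξ)).choose_spec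
    exact cech_unique hf h'' (h.smul a) (by rw [hp'', ← AdjoinRoot.smul_mk, hp]) hk

/-- `ev_y : I_f → H¹(ℙ¹, 𝒪(-3)) → H¹(ℙ¹, 𝒪(-2)) ≅ ℚ`, the second map being multiplication by `y`
and the third sending the class of `(xy)⁻¹` to `1`. -/
def evY {g : ℕ} (hf : IsCurveForm g f) : Lf f →ₗ[ℚ] ℚ :=
  boundaryCoeff hf (-1) (Or.inl rfl)

/-- `ev_x : I_f → H¹(ℙ¹, 𝒪(-3)) → H¹(ℙ¹, 𝒪(-2)) ≅ ℚ`, the second map being multiplication by `x`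
and the third sending the class of `(xy)⁻¹` to `1`. -/
def evX {g : ℕ} (hf : IsCurveForm g f) : Lf f →ₗ[ℚ] ℚ :=
  boundaryCoeff hf (-2) (Or.inr rfl)

/-- The symmetric bilinear form `ev_y ∘ φ` on `M_ℚ`. -/
def formY {g : ℕ} (hf : IsCurveForm g f) {U : MvPolynomial (Fin 2) ℤ} {D : EffectiveDivisor f d}
    (hD : D.DisjointFromBranch) (hU : IsEquationOf U D) : LinearMap.BilinForm ℚ D.Fibre :=
  (pairing hD hU).compr₂ (evY hf)

/-- The symmetric bilinear form `ev_x ∘ φ` on `M_ℚ`. -/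
def formX {g : ℕ} (hf : IsCurveForm g f) {U : MvPolynomial (Fin 2) ℤ} {D : EffectiveDivisor f d}
    (hD : D.DisjointFromBranch) (hU : IsEquationOf U D) : LinearMap.BilinForm ℚ D.Fibre :=
  (pairing hD hU).compr₂ (evX hf)

/-! ### The reduction covariant -/

section Covariant

variable {V : Type*} [AddCommGroup V] [Module ℝ V]

/-- The `ℂ`-basis `b` of `ℂ ⊗ V` diagonalises the two (complexified) bilinear forms. -/
def IsDiagonalizing (B₁ B₂ : LinearMap.BilinForm ℝ V)
    (b : Module.Basis (Fin (Module.finrank ℝ V)) ℂ (ℂ ⊗[ℝ] V)) : Prop :=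
  ∀ i j, i ≠ j →
    B₁.baseChange ℂ (b i) (b j) = 0 ∧ B₂.baseChange ℂ (b i) (b j) = 0

/-- The Hermitian form (linear in the first variable) on `ℂ ⊗ V` for which the basis `b` is
orthogonal, with `(bᵢ, bᵢ) = max(|(bᵢ, bᵢ)₁|, |(bᵢ, bᵢ)₂|)`. -/
def hermitianOfBasis (B₁ B₂ : LinearMap.BilinForm ℝ V)
    (b : Module.Basis (Fin (Module.finrank ℝ V)) ℂ (ℂ ⊗[ℝ] V)) (v w : ℂ ⊗[ℝ] V) : ℂ :=
  ∑ i, ((max ‖B₁.baseChange ℂ (b i) (b i)‖ ‖B₂.baseChange ℂ (b i) (b i)‖ : ℝ) : ℂ) *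
    b.repr v i * (starRingEnd ℂ) (b.repr w i)

open Classical in
/-- The reduction covariant `H` of a real vector space with two symmetric bilinear forms: the
restriction to `V` of the Hermitian form attached to a basis of `ℂ ⊗ V` that diagonalises both
forms (and `0` if there is no such basis). -/
def reductionCovariant (B₁ B₂ : LinearMap.BilinForm ℝ V) (v w : V) : ℂ :=
  if h : ∃ b, IsDiagonalizing B₁ B₂ b then
    hermitianOfBasis B₁ B₂ h.choose (1 ⊗ₜ v) (1 ⊗ₜ w)
  else 0

end Covariant

/-- The invariant binary form `f_{A,B}(x, y) = (-1)^{n(n-1)/2} det(A x - B y)`. -/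
def invariantForm {n : ℕ} (A B : Matrix (Fin n) (Fin n) ℤ) : MvPolynomial (Fin 2) ℤ :=
  (-1) ^ (n * (n - 1) / 2) *
    (Matrix.of fun i j => MvPolynomial.C (A i j) * MvPolynomial.X 0 -
      MvPolynomial.C (B i j) * MvPolynomial.X 1).det

/-- The reduction covariant `H_{A,B}` on `ℝⁿ` of a pair of integral symmetric matrices. -/
def matrixCovariant {n : ℕ} (A B : Matrix (Fin n) (Fin n) ℤ) (v w : Fin n → ℝ) : ℂ :=
  reductionCovariant (Matrix.toBilin' (A.map (Int.cast : ℤ → ℝ)))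
    (Matrix.toBilin' (B.map (Int.cast : ℤ → ℝ))) v w

/-- The sum `∑_{|ωᵢ| ≤ 1} |U(ωᵢ, 1)| / |f_x(ωᵢ, 1)| + ∑_{|ωᵢ| > 1} |U(1, ωᵢ⁻¹)| / |f_y(1, ωᵢ⁻¹)|`. -/
def rootSum {n : ℕ} (f U : MvPolynomial (Fin 2) ℤ) (ω : Fin n → ℂ) : ℝ :=
  ∑ i with ‖ω i‖ ≤ 1,
      ‖MvPolynomial.aeval ![ω i, 1] U‖ / ‖MvPolynomial.aeval ![ω i, 1] (MvPolynomial.pderiv 0 f)‖ +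
    ∑ i with 1 < ‖ω i‖,
      ‖MvPolynomial.aeval ![1, (ω i)⁻¹] U‖ /
        ‖MvPolynomial.aeval ![1, (ω i)⁻¹] (MvPolynomial.pderiv 1 f)‖

end HyperellipticReduction

end

open HyperellipticReduction

/-! The divisor `D` avoids `S_f`, so `1̄` trivialises the fibre: `M_ℚ = L_f · 1̄` with `L_f =
ℚ[X]/(f(X, 1))`, and `φ(p · 1̄, q · 1̄) = p q U` (`EffectiveDivisor.ofPoly_surjective`,
`pairing_ofPoly`). The linear forms are residue sums. On a representative of degree less than `n`,
`ev_y` is the coefficient of `X^{n-1}` divided by `f₀`, which by Euler's formula is `∑ ξ(ωᵢ) /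
f_x(ωᵢ, 1)`; moreover `ev_x = ev_y ∘ X` (`evY_eq_sum`, `evX_eq_sum`). The roots are distinct, so by
Vandermonde the evaluations at them are coordinates on `M_ℂ`. In these coordinates both forms are
diagonal, with entries `αᵢ = U(ωᵢ, 1) / f_x(ωᵢ, 1)` and `αᵢ ωᵢ`.

The `αᵢ` are nonzero and the `ωᵢ` distinct, so every diagonalising basis consists of multiples of
the coordinate vectors, and the Hermitian form is insensitive to the scaling: `(v, v)_H = ∑
max(|αᵢ|, |αᵢ ωᵢ|) |vᵢ|²` (`IsDiagonalIn.reductionCovariant_self`). All coordinates of `1̄` equal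
`1`, so its norm is `∑ max(|αᵢ|, |αᵢ ωᵢ|)`. A root with `|ωᵢ| ≤ 1` contributes `|αᵢ|`, any other
`|αᵢ ωᵢ|`, which homogeneity and Euler's identity rewrite in the chart `x = 1`
(`IsCurveForm.rootSum_eq`).

The computation involves the real space only through its Gram matrices in some basis
(`reductionCovariant_of_gram`), so it applies equally to `M_ℝ` and to `ℝⁿ` with the forms given by
`A`, `B`. -/

noncomputable section

namespace HyperellipticReduction

/-! ### The reduction covariant of a pair of diagonal forms -/

section DiagonalForms

variable {V : Type*} [AddCommGroup V] [Module ℝ V] {n : ℕ}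

/-- The pair of forms on `ℂ ⊗ V` given, in the coordinates `E`, by the diagonal matrices with
entries `αᵢ` and `αᵢ ωᵢ`. -/
structure IsDiagonalIn (B₁ B₂ : LinearMap.BilinForm ℝ V) (E : (ℂ ⊗[ℝ] V) ≃ₗ[ℂ] (Fin n → ℂ))
    (α ω : Fin n → ℂ) : Prop where
  fst : ∀ x y, B₁.baseChange ℂ x y = ∑ i, α i * E x i * E y i
  snd : ∀ x y, B₂.baseChange ℂ x y = ∑ i, α i * ω i * E x i * E y i

variable {B₁ B₂ : LinearMap.BilinForm ℝ V} {E : (ℂ ⊗[ℝ] V) ≃ₗ[ℂ] (Fin n → ℂ)} {α ω : Fin n → ℂ}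

lemma IsDiagonalIn.fst_single (h : IsDiagonalIn B₁ B₂ E α ω) (x : ℂ ⊗[ℝ] V) (k : Fin n) :
    B₁.baseChange ℂ x (E.symm (Pi.single k 1)) = α k * E x k := by
  rw [h.fst, Finset.sum_eq_single k]
  · simp
  · intro i _ hi
    simp [hi]
  · simp

lemma IsDiagonalIn.snd_single (h : IsDiagonalIn B₁ B₂ E α ω) (x : ℂ ⊗[ℝ] V) (k : Fin n) :
    B₂.baseChange ℂ x (E.symm (Pi.single k 1)) = α k * ω k * E x k := by
  rw [h.snd, Finset.sum_eq_single k]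
  · simp
  · intro i _ hi
    simp [hi]
  · simp

lemma finrank_eq_of_complex_coordinates (E : (ℂ ⊗[ℝ] V) ≃ₗ[ℂ] (Fin n → ℂ)) :
    Module.finrank ℝ V = n := by
  have h := E.finrank_eq
  rwa [Module.finrank_baseChange, Module.finrank_fin_fun] at h

/-- The vectors of a diagonalising basis are, up to scaling, coordinate vectors. -/
lemma IsDiagonalIn.exists_eq_single (h : IsDiagonalIn B₁ B₂ E α ω) (hα : ∀ i, α i ≠ 0)
    (hω : Function.Injective ω) {b : Module.Basis (Fin (Module.finrank ℝ V)) ℂ (ℂ ⊗[ℝ] V)}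
    (hb : IsDiagonalizing B₁ B₂ b) (i : Fin (Module.finrank ℝ V)) :
    ∃ (k : Fin n) (c : ℂ), c ≠ 0 ∧ E (b i) = Pi.single k c := by
  obtain ⟨k, hk⟩ : ∃ k, E (b i) k ≠ 0 := by
    by_contra! h0
    exact b.ne_zero i (E.map_eq_zero_iff.mp (funext h0))
  -- The first form is nondegenerate, since all `αᵢ ≠ 0`. If `b i` were isotropic it would be
  -- orthogonal to the whole basis, contradicting its nonzero pairing with the `k`-th coordinate
  -- vector.
  have hne : B₁.baseChange ℂ (b i) (b i) ≠ 0 := by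
    intro h0
    have h1 : B₁.baseChange ℂ (b i) = 0 := by
      refine b.ext fun j => ?_
      by_cases hij : i = j
      · subst hij
        exact h0
      · exact (hb i j hij).1
    have h2 := h.fst_single (b i) k
    rw [h1, LinearMap.zero_apply] at h2
    exact mul_ne_zero (hα k) hk h2.symm
  set μ := B₂.baseChange ℂ (b i) (b i) / B₁.baseChange ℂ (b i) (b i) with hμ
  -- Thus `b i` is an eigenvector, with eigenvalue `μ`, of the pencil of the two forms. Its
  -- eigenvalues on the coordinate vectors are the distinct `ω l`, so only one coordinate of `b i`
  -- can be nonzero.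
  have hprop : B₂.baseChange ℂ (b i) = μ • B₁.baseChange ℂ (b i) := by
    refine b.ext fun j => ?_
    by_cases hij : i = j
    · subst hij
      rw [LinearMap.smul_apply, smul_eq_mul, hμ, div_mul_cancel₀ _ hne]
    · rw [LinearMap.smul_apply, (hb i j hij).1, (hb i j hij).2, smul_zero]
  have heig : ∀ l, E (b i) l ≠ 0 → ω l = μ := by
    intro l hl
    have h1 := h.snd_single (b i) l
    rw [hprop, LinearMap.smul_apply, h.fst_single, smul_eq_mul] at h1
    have h2 : (α l * E (b i) l) * ω l = (α l * E (b i) l) * μ := by linear_combination -h1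
    exact mul_left_cancel₀ (mul_ne_zero (hα l) hl) h2
  refine ⟨k, E (b i) k, hk, funext fun l => ?_⟩
  by_cases hlk : l = k
  · subst hlk
    simp
  · rw [Pi.single_eq_of_ne hlk]
    by_contra hl
    exact hlk (hω ((heig l hl).trans (heig k hk).symm))

/-- The basis vectors are `c i` times distinct coordinate vectors. Replacing a vector by its
multiple by `c` scales the weight by `|c|²` and the squared norm of the coefficient by `|c|⁻²`, so
the form is the one attached to the coordinate basis itself. -/
lemma IsDiagonalIn.hermitianOfBasis_self (h : IsDiagonalIn B₁ B₂ E α ω) (hα : ∀ i, α i ≠ 0)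
    (hω : Function.Injective ω) {b : Module.Basis (Fin (Module.finrank ℝ V)) ℂ (ℂ ⊗[ℝ] V)}
    (hb : IsDiagonalizing B₁ B₂ b) (v : ℂ ⊗[ℝ] V) :
    hermitianOfBasis B₁ B₂ b v v =
      ((∑ k, max ‖α k‖ ‖α k * ω k‖ * ‖E v k‖ ^ 2 : ℝ) : ℂ) := by
  choose σ c hc hσ using h.exists_eq_single hα hω hb
  -- Two basis vectors on the same coordinate line would pair to `α c c' ≠ 0` under the first form.
  have hinj : Function.Injective σ := by
    intro i j hij
    by_contra hne
    have h1 := (hb i j hne).1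
    rw [h.fst, hσ i, hσ j, hij, Finset.sum_eq_single (σ j)] at h1
    · simp [hα, hc] at h1
    · intro l _ hl
      simp [hl]
    · simp
  have hbij : Function.Bijective σ := by
    rw [Fintype.bijective_iff_injective_and_card]
    exact ⟨hinj, by simpa using finrank_eq_of_complex_coordinates E⟩
  have hrepr : ∀ i, E v (σ i) = b.repr v i * c i := by
    intro i
    conv_lhs => rw [← b.sum_repr v]
    rw [map_sum, Finset.sum_apply, Finset.sum_eq_single i]
    · simp [hσ]
    · intro j _ hj
      have : σ i ≠ σ j := fun e => hj (hinj e).symm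
      simp [hσ, this]
    · simp
  have h1 : ∀ i, B₁.baseChange ℂ (b i) (b i) = α (σ i) * c i ^ 2 := by
    intro i
    rw [h.fst, hσ i, Finset.sum_eq_single (σ i)]
    · simp; ring
    · intro l _ hl
      simp [hl]
    · simp
  have h2 : ∀ i, B₂.baseChange ℂ (b i) (b i) = α (σ i) * ω (σ i) * c i ^ 2 := by
    intro i
    rw [h.snd, hσ i, Finset.sum_eq_single (σ i)]
    · simp; ring
    · intro l _ hl
      simp [hl]
    · simp
  rw [← hbij.sum_comp, hermitianOfBasis, Complex.ofReal_sum]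
  refine Finset.sum_congr rfl fun i _ => ?_
  rw [h1, h2, hrepr, mul_assoc, Complex.mul_conj, Complex.normSq_eq_norm_sq, ← Complex.ofReal_mul]
  congr 1
  rw [norm_mul, norm_mul (α (σ i) * ω (σ i)), norm_pow, norm_mul _ (c i),
    ← max_mul_of_nonneg _ _ (by positivity)]
  ring

/-- Ensures that `reductionCovariant` is not its default value `0`. -/
lemma IsDiagonalIn.exists_isDiagonalizing (h : IsDiagonalIn B₁ B₂ E α ω) :
    ∃ b, IsDiagonalizing B₁ B₂ b := by
  refine ⟨((Pi.basisFun ℂ (Fin n)).map E.symm).reindex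
    (finCongr (finrank_eq_of_complex_coordinates E).symm), fun i j hij => ?_⟩
  have hne : (finCongr (finrank_eq_of_complex_coordinates E).symm).symm j ≠
      (finCongr (finrank_eq_of_complex_coordinates E).symm).symm i :=
    fun e => hij (Equiv.injective _ e).symm
  simp only [Module.Basis.reindex_apply, Module.Basis.map_apply, Pi.basisFun_apply]
  rw [h.fst_single, h.snd_single, LinearEquiv.apply_symm_apply, Pi.single_eq_of_ne hne]
  simp

/-- The reduction covariant of a pair of forms that are diagonal in complex coordinates `E`. -/
theorem IsDiagonalIn.reductionCovariant_self (h : IsDiagonalIn B₁ B₂ E α ω) (hα : ∀ i, α i ≠ 0)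
    (hω : Function.Injective ω) (v : V) :
    reductionCovariant B₁ B₂ v v =
      ((∑ k, max ‖α k‖ ‖α k * ω k‖ * ‖E (1 ⊗ₜ v) k‖ ^ 2 : ℝ) : ℂ) := by
  have hex := h.exists_isDiagonalizing
  rw [reductionCovariant, dif_pos hex]
  exact h.hermitianOfBasis_self hα hω hex.choose_spec _

lemma bilinForm_baseChange_eq_sum (B : LinearMap.BilinForm ℝ V) (c : Module.Basis (Fin n) ℝ V)
    (E : (ℂ ⊗[ℝ] V) →ₗ[ℂ] (Fin n → ℂ)) (β : Fin n → ℂ)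
    (h : ∀ k l, (B (c k) (c l) : ℂ) = ∑ i, β i * E (1 ⊗ₜ c k) i * E (1 ⊗ₜ c l) i)
    (x y : ℂ ⊗[ℝ] V) : B.baseChange ℂ x y = ∑ i, β i * E x i * E y i := by
  have hB : B.baseChange ℂ = ∑ i, β i • (LinearMap.mul ℂ ℂ).compl₁₂
      ((LinearMap.proj i).comp E) ((LinearMap.proj i).comp E) := by
    refine (c.baseChange ℂ).ext fun k => (c.baseChange ℂ).ext fun l => ?_
    rw [Module.Basis.baseChange_apply, Module.Basis.baseChange_apply,
      LinearMap.BilinForm.baseChange_tmul]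
    simp [LinearMap.sum_apply, h, mul_assoc]
  rw [hB]
  simp [LinearMap.sum_apply, mul_assoc]

/-- The reduction covariant of the pair of forms with Gram matrices `P diag(α) Pᵀ` and
`P diag(αω) Pᵀ`. -/
theorem reductionCovariant_of_gram (c : Module.Basis (Fin n) ℝ V) {P : Matrix (Fin n) (Fin n) ℂ}
    (hP : ∀ x, P.mulVec x = 0 → x = 0) (hα : ∀ i, α i ≠ 0) (hω : Function.Injective ω)
    (h₁ : ∀ k l, (B₁ (c k) (c l) : ℂ) = ∑ i, α i * P k i * P l i)
    (h₂ : ∀ k l, (B₂ (c k) (c l) : ℂ) = ∑ i, α i * ω i * P k i * P l i) (w : Fin n → ℝ) :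
    reductionCovariant B₁ B₂ (∑ k, w k • c k) (∑ k, w k • c k) =
      ((∑ i, max ‖α i‖ ‖α i * ω i‖ * ‖∑ k, (w k : ℂ) * P k i‖ ^ 2 : ℝ) : ℂ) := by
  -- Trivial kernel makes the square matrix `P` invertible, so its rows form a basis of `ℂⁿ`; `E` is
  -- the coordinate system taking `c k` to row `k`.
  have hunit : IsUnit P := by
    rw [← Matrix.mulVec_injective_iff_isUnit]
    exact (injective_iff_map_eq_zero P.mulVecLin).mpr hP
  have hli : LinearIndependent ℂ P.row := Matrix.linearIndependent_rows_of_isUnit hunit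
  let p : Module.Basis (Fin n) ℂ (Fin n → ℂ) :=
    Module.Basis.mk hli (hli.span_eq_top_of_card_eq_finrank' (by simp)).ge
  have hp : ∀ k, p k = P k := fun k => Module.Basis.mk_apply _ _ k
  let E : (ℂ ⊗[ℝ] V) ≃ₗ[ℂ] (Fin n → ℂ) := (c.baseChange ℂ).equiv p (Equiv.refl _)
  have hE : ∀ k, E (1 ⊗ₜ c k) = P k := by
    intro k
    rw [← Module.Basis.baseChange_apply, ← hp]
    exact (c.baseChange ℂ).equiv_apply _ _ _
  have hd : IsDiagonalIn B₁ B₂ E α ω :=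
    ⟨bilinForm_baseChange_eq_sum B₁ c E.toLinearMap α (by simpa [hE] using h₁),
      bilinForm_baseChange_eq_sum B₂ c E.toLinearMap (fun i => α i * ω i) (by simpa [hE] using h₂)⟩
  rw [hd.reductionCovariant_self hα hω]
  have hv : E (1 ⊗ₜ ∑ k, w k • c k) = ∑ k, (w k : ℂ) • P k := by
    rw [TensorProduct.tmul_sum, map_sum]
    refine Finset.sum_congr rfl fun k _ => ?_
    rw [← TensorProduct.smul_tmul, ← hE, ← map_smul, TensorProduct.smul_tmul']
    simp
  simp [hv, Finset.sum_apply]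

end DiagonalForms

/-! ### Forms and their dehomogenisations -/

section Forms

open MvPolynomial (C X)

variable {f : MvPolynomial (Fin 2) ℤ} {g : ℕ}

lemma eval_dehom (K : Type*) [Field K] (F : MvPolynomial (Fin 2) ℤ) (a : K) :
    (dehom K F).eval a = MvPolynomial.aeval ![a, 1] F := by
  have h : ∀ F : MvPolynomial (Fin 2) ℤ,
      ((Polynomial.evalRingHom a).comp
        (MvPolynomial.aeval ![(Polynomial.X : K[X]), 1]).toRingHom) F =
      (MvPolynomial.aeval ![a, 1]).toRingHom F := by
    intro F
    congr 1
    apply MvPolynomial.ringHom_ext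
    · intro r; simp
    · intro i; fin_cases i <;> simp
  simpa [dehom] using h F

lemma derivative_dehom (K : Type*) [Field K] (F : MvPolynomial (Fin 2) ℤ) :
    Polynomial.derivative (dehom K F) = dehom K (MvPolynomial.pderiv 0 F) := by
  induction F using MvPolynomial.induction_on with
  | C a => simp [dehom]
  | add p q hp hq => simpa [dehom] using congrArg₂ (· + ·) hp hq
  | mul_X p i hp =>
    unfold dehom at *
    fin_cases i <;> simp [Polynomial.derivative_mul, hp, Derivation.leibniz, mul_comm]

lemma dehom_eq_eval₂_map (K : Type*) [Field K] (F : MvPolynomial (Fin 2) ℤ) :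
    dehom K F = MvPolynomial.eval₂Hom (Polynomial.C : K →+* K[X]) ![Polynomial.X, 1]
      (MvPolynomial.map (Int.castRingHom K) F) := by
  rw [MvPolynomial.coe_eval₂Hom, MvPolynomial.eval₂_map, dehom, MvPolynomial.aeval_def]
  congr 1

/-- The roots of a form of nonzero discriminant are distinct. -/
lemma IsCurveForm.root_injective (hf : IsCurveForm g f) {ω : Fin (2 * g + 2) → ℂ}
    (hω : (dehom ℂ f).roots = Finset.univ.val.map ω) : Function.Injective ω := by
  obtain ⟨α, β, hprod, hdisc⟩ := hf.discriminant
  have hα : ∀ i, α i ≠ 0 := by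
    intro i hi
    -- At `(1, 0)` the factorisation reads `f₀ = ∏ αᵢ`, so `f₀ ≠ 0` rules out a vanishing `αᵢ`.
    have h := congrArg (MvPolynomial.eval ![(1 : ℂ), 0]) hprod
    rw [map_prod, Finset.prod_eq_zero (Finset.mem_univ i) (by simp [hi]),
      MvPolynomial.eval_map] at h
    apply hf.f_zero_ne
    have h2 := MvPolynomial.eval₂_comp_left (Int.castRingHom ℂ) (RingHom.id ℤ) ![1, 0] f
    have h3 : (Int.castRingHom ℂ) ∘ ![(1 : ℤ), 0] = ![(1 : ℂ), 0] := by
      ext i; fin_cases i <;> simp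
    rw [h3, RingHom.comp_id, h] at h2
    exact (RingHom.injective_int (Int.castRingHom ℂ)) (h2.trans (map_zero _).symm)
  have hd : dehom ℂ f =
      Polynomial.C (∏ i, α i) * ∏ i, (Polynomial.X - Polynomial.C (β i / α i)) := by
    rw [dehom_eq_eval₂_map, hprod, map_prod, map_prod, ← Finset.prod_mul_distrib]
    refine Finset.prod_congr rfl fun i _ => ?_
    rw [mul_sub, ← Polynomial.C_mul, mul_div_cancel₀ _ (hα i)]
    simp
  have hroots : (∏ i, (Polynomial.X - Polynomial.C (β i / α i))).roots =
      Finset.univ.val.map fun i => β i / α i := by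
    rw [← Polynomial.roots_multiset_prod_X_sub_C (Multiset.map _ _), Multiset.map_map]
    rfl
  rw [hd, Polynomial.roots_C_mul _ (Finset.prod_ne_zero_iff.mpr fun i _ => hα i),
    hroots] at hω
  have hinj : Function.Injective fun i => β i / α i := by
    have hne : ∀ i j, i < j → β i / α i ≠ β j / α j := by
      intro i j hij h
      rw [div_eq_div_iff (hα i) (hα j)] at h
      have h1 := Finset.prod_ne_zero_iff.mp
        (Finset.prod_ne_zero_iff.mp hdisc i (Finset.mem_univ i)) j (Finset.mem_Ioi.mpr hij)
      exact h1 (by rw [sq_eq_zero_iff]; linear_combination -h)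
    intro i j h
    rcases lt_trichotomy i j with hij | hij | hij
    · exact absurd h (hne i j hij)
    · exact hij
    · exact absurd h.symm (hne j i hij)
  -- `ω` enumerates the same multiset as the distinct ratios `βᵢ / αᵢ`, possibly in another order;
  -- absence of repetitions carries over.
  have hnodup := (Multiset.nodup_map_iff_of_injective hinj).mpr Finset.univ.nodup
  rw [hω] at hnodup
  intro i j hij
  exact Multiset.inj_on_of_nodup_map hnodup i (Finset.mem_univ i) j (Finset.mem_univ j) hij

lemma IsCurveForm.natDegree_dehom_complex (hf : IsCurveForm g f) :
    (dehom ℂ f).natDegree = 2 * g + 2 := by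
  rw [← dehom_map (algebraMap ℚ ℂ), Polynomial.natDegree_map, natDegree_dehom hf]

lemma IsCurveForm.dehom_complex_eq (hf : IsCurveForm g f) {ω : Fin (2 * g + 2) → ℂ}
    (hω : (dehom ℂ f).roots = Finset.univ.val.map ω) :
    dehom ℂ f = Polynomial.C (dehom ℂ f).leadingCoeff * Lagrange.nodal Finset.univ ω := by
  have h := Polynomial.C_leadingCoeff_mul_prod_multiset_X_sub_C (p := dehom ℂ f)
    (by rw [hω, hf.natDegree_dehom_complex]; simp)
  rw [hω, Multiset.map_map] at h
  exact h.symm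

lemma IsCurveForm.dehom_complex_ne_zero (hf : IsCurveForm g f) : dehom ℂ f ≠ 0 :=
  Polynomial.ne_zero_of_natDegree_gt (n := 0) (by rw [hf.natDegree_dehom_complex]; omega)

lemma IsCurveForm.eval_root (hf : IsCurveForm g f) {ω : Fin (2 * g + 2) → ℂ}
    (hω : (dehom ℂ f).roots = Finset.univ.val.map ω) (i : Fin (2 * g + 2)) :
    (dehom ℂ f).eval (ω i) = 0 := by
  rw [hf.dehom_complex_eq hω, Polynomial.eval_mul,
    Lagrange.eval_nodal_at_node (Finset.mem_univ i), mul_zero]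

lemma IsCurveForm.eval_derivative_root (hf : IsCurveForm g f) {ω : Fin (2 * g + 2) → ℂ}
    (hω : (dehom ℂ f).roots = Finset.univ.val.map ω) (i : Fin (2 * g + 2)) :
    (dehom ℂ f).derivative.eval (ω i) =
      (dehom ℂ f).leadingCoeff * ∏ j ∈ Finset.univ.erase i, (ω i - ω j) := by
  conv_lhs => rw [hf.dehom_complex_eq hω]
  rw [Polynomial.derivative_C_mul, Polynomial.eval_mul, Polynomial.eval_C,
    Lagrange.eval_nodal_derivative_eval_node_eq (Finset.mem_univ i), Lagrange.eval_nodal]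

lemma IsCurveForm.eval_derivative_root_ne_zero (hf : IsCurveForm g f) {ω : Fin (2 * g + 2) → ℂ}
    (hω : (dehom ℂ f).roots = Finset.univ.val.map ω) (i : Fin (2 * g + 2)) :
    (dehom ℂ f).derivative.eval (ω i) ≠ 0 := by
  rw [hf.eval_derivative_root hω]
  refine mul_ne_zero (Polynomial.leadingCoeff_ne_zero.mpr hf.dehom_complex_ne_zero)
    (Finset.prod_ne_zero_iff.mpr fun j hj => sub_ne_zero.mpr fun h => ?_)
  exact Finset.ne_of_mem_erase hj (hf.root_injective hω h).symm

/-- Euler's formula for `∑ P(ωᵢ) / f_x(ωᵢ, 1)`, where `P` has degree less than `n`. -/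
lemma IsCurveForm.sum_eval_div_derivative (hf : IsCurveForm g f) {ω : Fin (2 * g + 2) → ℂ}
    (hω : (dehom ℂ f).roots = Finset.univ.val.map ω) {P : ℂ[X]} (hP : P.natDegree < 2 * g + 2) :
    ∑ i, P.eval (ω i) / (dehom ℂ f).derivative.eval (ω i) =
      P.coeff (2 * g + 1) / (dehom ℂ f).leadingCoeff := by
  -- Compare top coefficients in the Lagrange interpolation of `P` at the `n` roots.
  have h := Lagrange.coeff_eq_sum (s := Finset.univ) (v := ω) (hf.root_injective hω).injOn
    (P := P) (by
      rw [Finset.card_univ, Fintype.card_fin]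
      exact Polynomial.degree_le_natDegree.trans_lt (by exact_mod_cast hP))
  rw [Finset.card_univ, Fintype.card_fin] at h
  rw [show 2 * g + 1 = 2 * g + 2 - 1 by omega, h, Finset.sum_div]
  refine Finset.sum_congr rfl fun i _ => ?_
  rw [hf.eval_derivative_root hω, div_div, mul_comm (Polynomial.leadingCoeff _)]

/-! ### Passing between the charts `y = 1` and `x = 1`. -/

lemma aeval_smul_of_isHomogeneous {F : MvPolynomial (Fin 2) ℤ} {m : ℕ} (hF : F.IsHomogeneous m)
    {c : ℂ} (hc : c ≠ 0) :
    MvPolynomial.aeval ![c, 1] F = c ^ m * MvPolynomial.aeval ![1, c⁻¹] F := by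
  simp only [MvPolynomial.aeval_def, MvPolynomial.eval₂_eq', Finset.mul_sum]
  refine Finset.sum_congr rfl fun e he => ?_
  have h : e 0 + e 1 = m := by
    have := hF (MvPolynomial.mem_support_iff.mp he)
    simpa [Finsupp.weight_apply, Finsupp.sum_fintype] using this
  simp only [Fin.prod_univ_two, Matrix.cons_val_zero, Matrix.cons_val_one, one_pow, mul_one,
    one_mul, ← h, pow_add]
  have h1 : c ^ e 1 * c⁻¹ ^ e 1 = 1 := by rw [← mul_pow, mul_inv_cancel₀ hc, one_pow]
  linear_combination -(algebraMap ℤ ℂ (F.coeff e) * c ^ e 0) * h1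

/-- Euler's identity at a zero of a form. -/
lemma aeval_pderiv_one_of_eq_zero {F : MvPolynomial (Fin 2) ℤ} {m : ℕ} (hF : F.IsHomogeneous m)
    {c : ℂ} (hc : MvPolynomial.aeval ![c, 1] F = 0) :
    MvPolynomial.aeval ![c, 1] (MvPolynomial.pderiv 1 F) =
      -(c * MvPolynomial.aeval ![c, 1] (MvPolynomial.pderiv 0 F)) := by
  have h := congrArg (MvPolynomial.aeval ![c, 1]) hF.sum_X_mul_pderiv
  rw [Fin.sum_univ_two, map_add, map_mul, map_mul, map_nsmul, hc, smul_zero] at h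
  simp only [MvPolynomial.aeval_X, Matrix.cons_val_zero, Matrix.cons_val_one, one_mul] at h
  linear_combination h

/-- The condition `|ωᵢ| ≤ 1` decides which entry of `max(|αᵢ|, |αᵢ ωᵢ|)` is larger. For `|ωᵢ| > 1`,
homogeneity together with `f_y(ω, 1) = -ω f_x(ω, 1)` gives `U(1, ω⁻¹) / f_y(1, ω⁻¹) = -ω U(ω, 1) /
f_x(ω, 1)`. -/
lemma IsCurveForm.rootSum_eq (hf : IsCurveForm g f) (hg : 1 ≤ g) {U : MvPolynomial (Fin 2) ℤ}
    (hU : U.IsHomogeneous (2 * g - 1)) {ω : Fin (2 * g + 2) → ℂ}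
    (hω : (dehom ℂ f).roots = Finset.univ.val.map ω) :
    rootSum f U ω =
      ∑ i, max ‖(dehom ℂ U).eval (ω i) / (dehom ℂ f).derivative.eval (ω i)‖
        ‖(dehom ℂ U).eval (ω i) / (dehom ℂ f).derivative.eval (ω i) * ω i‖ := by
  rw [rootSum, ← Finset.sum_filter_add_sum_filter_not Finset.univ fun i => ‖ω i‖ ≤ 1]
  simp only [derivative_dehom, eval_dehom, not_le]
  congr 1
  · refine Finset.sum_congr rfl fun i hi => ?_
    rw [norm_mul, max_eq_left, norm_div]
    exact mul_le_of_le_one_right (norm_nonneg _) (Finset.mem_filter.mp hi).2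
  · refine Finset.sum_congr rfl fun i hi => ?_
    have h1 : 1 < ‖ω i‖ := (Finset.mem_filter.mp hi).2
    have h0 : ω i ≠ 0 := norm_pos_iff.mp (by linarith)
    rw [norm_mul, max_eq_right (le_mul_of_one_le_right (norm_nonneg _) h1.le), ← norm_mul,
      ← norm_div]
    have hy := aeval_pderiv_one_of_eq_zero hf.homogeneous
      (by rw [← eval_dehom]; exact hf.eval_root hω i)
    have hx : MvPolynomial.aeval ![ω i, 1] (MvPolynomial.pderiv 0 f) ≠ 0 := by
      rw [← eval_dehom, ← derivative_dehom]
      exact hf.eval_derivative_root_ne_zero hω i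
    rw [aeval_smul_of_isHomogeneous (hf.homogeneous.pderiv (i := 1)) h0] at hy
    rw [aeval_smul_of_isHomogeneous hU h0]
    have hy' : MvPolynomial.aeval ![1, (ω i)⁻¹] (MvPolynomial.pderiv 1 f) ≠ 0 := by
      intro h
      rw [h, mul_zero] at hy
      exact mul_ne_zero h0 hx (neg_eq_zero.mp hy.symm)
    rw [← norm_neg]
    congr 1
    rw [div_mul_eq_mul_div, ← neg_div, div_eq_div_iff hy' hx]
    -- The degrees of `f_y` and `U` differ by `2`. The assumption `1 ≤ g` is needed because `2 * g -
    -- 1` is a truncated subtraction.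
    have hpow : ω i ^ (2 * g + 2 - 1) = ω i ^ (2 * g - 1) * ω i ^ 2 := by
      rw [← pow_add]
      congr 1
      omega
    rw [hpow] at hy
    apply mul_left_cancel₀ h0
    linear_combination -MvPolynomial.aeval ![1, (ω i)⁻¹] U * hy

end Forms

/-! ### The linear forms `ev_y` and `ev_x` -/

section Evaluation

variable {f : MvPolynomial (Fin 2) ℤ} {g : ℕ}

/-- Divide by `X²`: `p - X⁻² w = F · X⁻² Q`. Since `deg w ≤ N`, the section `X⁻² w` of `𝒪(N - 2)` is
regular on the other chart, so the Čech class is `X⁻² Q`. -/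
lemma isCechLift_of_eq {F p Q w : ℚ[X]} {N : ℕ} (h : Polynomial.X ^ 2 * p = F * Q + w)
    (hw : w.natDegree ≤ N) :
    ∃ q : ℚ[X], IsCechLift F (N - 2) p q (LaurentPolynomial.T (-2) * Polynomial.toLaurent Q) := by
  obtain ⟨q, hq⟩ := exists_invert _ N hw
  refine ⟨q, ?_⟩
  have h1 := congrArg Polynomial.toLaurent h
  rw [map_add, map_mul, map_mul, hq, Polynomial.toLaurent_X_pow] at h1
  have h2 : (LaurentPolynomial.T (-2) * LaurentPolynomial.T ((2 : ℕ) : ℤ) : ℚ[T;T⁻¹]) = 1 := by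
    rw [← LaurentPolynomial.T_add, ← LaurentPolynomial.T_zero]
    rfl
  have h3 : (LaurentPolynomial.T ((N : ℤ) - 2) : ℚ[T;T⁻¹]) =
      LaurentPolynomial.T (-2) * LaurentPolynomial.T N := by
    rw [← LaurentPolynomial.T_add]
    congr 1
  unfold IsCechLift
  rw [h3]
  linear_combination (-Polynomial.toLaurent p) * h2 + LaurentPolynomial.T (-2) * h1

/-- Reads the two coefficients of the class `X⁻² Q` that matter: `Q₁` at `X⁻¹` for `ev_y`, and `Q₀`
at `X⁻²` for `ev_x`. -/
lemma coeff_T_mul_toLaurent (Q : ℚ[X]) (k : ℕ) :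
    (LaurentPolynomial.T (-2) * Polynomial.toLaurent Q : ℚ[T;T⁻¹]).coeff (k - 2 : ℤ) =
      Q.coeff k := by
  have h : (LaurentPolynomial.T (-2) * Polynomial.toLaurent Q : ℚ[T;T⁻¹]).coeff (k - 2 : ℤ) =
      (Polynomial.toLaurent Q).coeff (k : ℤ) := by
    have := AddMonoidAlgebra.coeff_single_mul_add (Polynomial.toLaurent Q) (1 : ℚ) (-2 : ℤ) (k : ℤ)
    rwa [one_mul, neg_add_eq_sub] at this
  rw [h, LaurentPolynomial.coeff_toLaurent]
  exact Finsupp.mapDomain_apply Nat.castEmbedding.injective _ k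

/-- `boundaryCoeff` is defined through a chosen lift; by `cech_unique` the lift given by any such
division yields the same coefficient. -/
lemma boundaryCoeff_mk (hf : IsCurveForm g f) {p Q w : ℚ[X]}
    (h : Polynomial.X ^ 2 * p = dehom ℚ f * Q + w) (hw : w.natDegree ≤ 2 * g + 1) {k : ℤ}
    (hk : k = -1 ∨ k = -2) :
    boundaryCoeff hf k hk (AdjoinRoot.mk (dehom ℚ f) p) =
      (LaurentPolynomial.T (-2) * Polynomial.toLaurent Q : ℚ[T;T⁻¹]).coeff k := by
  obtain ⟨q, hq⟩ := isCechLift_of_eq h hw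
  have h2 : ((2 * g + 1 : ℕ) : ℤ) - 2 = 2 * g - 1 := by push_cast; ring
  rw [h2] at hq
  obtain ⟨p', q', hp', h'⟩ := (exists_cechLift_Lf hf (AdjoinRoot.mk (dehom ℚ f) p)).choose_spec
  exact cech_unique hf h' hq hp' hk

lemma evY_mk (hf : IsCurveForm g f) {p Q w : ℚ[X]}
    (h : Polynomial.X ^ 2 * p = dehom ℚ f * Q + w) (hw : w.natDegree ≤ 2 * g + 1) :
    evY hf (AdjoinRoot.mk (dehom ℚ f) p) = Q.coeff 1 :=
  (boundaryCoeff_mk hf h hw _).trans (coeff_T_mul_toLaurent Q 1)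

lemma evX_mk (hf : IsCurveForm g f) {p Q w : ℚ[X]}
    (h : Polynomial.X ^ 2 * p = dehom ℚ f * Q + w) (hw : w.natDegree ≤ 2 * g + 1) :
    evX hf (AdjoinRoot.mk (dehom ℚ f) p) = Q.coeff 0 :=
  (boundaryCoeff_mk hf h hw _).trans (coeff_T_mul_toLaurent Q 0)

lemma IsCurveForm.natDegree_mod_le (hf : IsCurveForm g f) (p : ℚ[X]) :
    (p % dehom ℚ f).natDegree ≤ 2 * g + 1 := by
  have := Polynomial.natDegree_mod_lt p (q := dehom ℚ f) (by rw [natDegree_dehom hf]; omega)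
  rw [natDegree_dehom hf] at this
  omega

lemma IsCurveForm.leadingCoeff_ne_zero (hf : IsCurveForm g f) : (dehom ℚ f).leadingCoeff ≠ 0 :=
  Polynomial.leadingCoeff_ne_zero.mpr
    (Polynomial.ne_zero_of_natDegree_gt (n := 0) (by rw [natDegree_dehom hf]; omega))

lemma natDegree_div_le_of_le {K : Type*} [Field K] {p q : K[X]} {m : ℕ}
    (h : p.natDegree ≤ q.natDegree + m) : (p / q).natDegree ≤ m := by
  by_cases hq : q = 0
  · simp [hq]
  rw [Polynomial.div_def]
  refine (Polynomial.natDegree_C_mul_le _ _).trans ?_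
  rw [Polynomial.natDegree_divByMonic _ (Polynomial.monic_mul_leadingCoeff_inv hq),
    Polynomial.natDegree_mul_leadingCoeff_inv _ hq]
  omega

/-- `ev_x = ev_y ∘ X`. -/
lemma evX_eq_evY_root_mul (hf : IsCurveForm g f) (ξ : Lf f) :
    evX hf ξ = evY hf (AdjoinRoot.root (dehom ℚ f) * ξ) := by
  obtain ⟨p, rfl⟩ := AdjoinRoot.mk_surjective ξ
  have h := (EuclideanDomain.div_add_mod (Polynomial.X ^ 2 * p) (dehom ℚ f)).symm
  have hw := hf.natDegree_mod_le (Polynomial.X ^ 2 * p)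
  rw [evX_mk hf h hw, ← AdjoinRoot.mk_X, ← map_mul]
  generalize Polynomial.X ^ 2 * p / dehom ℚ f = Q at h
  generalize Polynomial.X ^ 2 * p % dehom ℚ f = w at h hw
  -- Multiplying the division by `X` shifts the quotient to `X Q`, up to the quotient of `X w` by
  -- `f`. That correction is a constant, so the coefficient of `X` becomes `Q₀`.
  have h1 : Polynomial.X ^ 2 * (Polynomial.X * p) =
      dehom ℚ f * (Polynomial.X * Q + Polynomial.X * w / dehom ℚ f) +
        Polynomial.X * w % dehom ℚ f := by
    linear_combination
      Polynomial.X * h - EuclideanDomain.div_add_mod (Polynomial.X * w) (dehom ℚ f)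
  have h2 : (Polynomial.X * w / dehom ℚ f).natDegree ≤ 0 := by
    have h3 : (Polynomial.X * w).natDegree ≤ 2 * g + 2 :=
      Polynomial.natDegree_mul_le.trans (by rw [Polynomial.natDegree_X]; omega)
    refine natDegree_div_le_of_le ?_
    rw [natDegree_dehom hf]
    omega
  rw [evY_mk hf h1 (hf.natDegree_mod_le _), Polynomial.coeff_add,
    Polynomial.coeff_eq_zero_of_natDegree_lt (p := Polynomial.X * w / dehom ℚ f) (by omega),
    add_zero, Polynomial.coeff_X_mul]

/-- Here `X² p` has degree at most `n + 1`, so its quotient by `f` is at most linear; the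
coefficients of `X^{n+1}` on both sides give `p_{n-1} = f₀ Q₁`. -/
lemma evY_mk_of_natDegree_le (hf : IsCurveForm g f) {p : ℚ[X]} (hp : p.natDegree ≤ 2 * g + 1) :
    evY hf (AdjoinRoot.mk (dehom ℚ f) p) = p.coeff (2 * g + 1) / (dehom ℚ f).leadingCoeff := by
  have h := (EuclideanDomain.div_add_mod (Polynomial.X ^ 2 * p) (dehom ℚ f)).symm
  have hw := hf.natDegree_mod_le (Polynomial.X ^ 2 * p)
  have hQ : (Polynomial.X ^ 2 * p / dehom ℚ f).natDegree ≤ 1 := by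
    have h3 : (Polynomial.X ^ 2 * p).natDegree ≤ 2 * g + 3 :=
      Polynomial.natDegree_mul_le.trans (by rw [Polynomial.natDegree_X_pow]; omega)
    refine natDegree_div_le_of_le ?_
    rw [natDegree_dehom hf]
    omega
  rw [evY_mk hf h hw, eq_div_iff hf.leadingCoeff_ne_zero]
  have h1 := congrArg (Polynomial.coeff · (2 * g + 2 + 1)) h
  simp only [Polynomial.coeff_add] at h1
  rw [Polynomial.coeff_mul_add_eq_of_natDegree_le (natDegree_dehom hf).le hQ,
    Polynomial.coeff_eq_zero_of_natDegree_lt (n := 2 * g + 2 + 1) (lt_of_le_of_lt hw (by omega)),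
    add_zero, show 2 * g + 2 + 1 = (2 * g + 1) + 2 by omega, Polynomial.coeff_X_pow_mul] at h1
  rw [h1, Polynomial.leadingCoeff, natDegree_dehom hf, mul_comm]

/-- Evaluation of elements of `L_f` at a complex root of `f(X, 1)`. -/
def evalAt {z : ℂ} (hz : (dehom ℂ f).eval z = 0) : Lf f →ₐ[ℚ] ℂ :=
  AdjoinRoot.liftAlgHom (dehom ℚ f) (Algebra.ofId ℚ ℂ) z (by
    rw [← dehom_map (algebraMap ℚ ℂ), Polynomial.eval_map] at hz
    exact hz)

lemma evalAt_mk {z : ℂ} (hz : (dehom ℂ f).eval z = 0) (p : ℚ[X]) :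
    evalAt hz (AdjoinRoot.mk (dehom ℚ f) p) = (p.map (algebraMap ℚ ℂ)).eval z := by
  rw [Polynomial.eval_map]
  rfl

lemma evalAt_root {z : ℂ} (hz : (dehom ℂ f).eval z = 0) :
    evalAt hz (AdjoinRoot.root (dehom ℚ f)) = z :=
  AdjoinRoot.liftAlgHom_root _ _ _ _

/-- Both sides depend only on the class modulo `f`; on the reduced representative each is the
coefficient of `X^{n-1}` divided by `f₀`, the right side by Euler's formula. -/
lemma evY_eq_sum (hf : IsCurveForm g f) {ω : Fin (2 * g + 2) → ℂ}
    (hω : (dehom ℂ f).roots = Finset.univ.val.map ω) (ξ : Lf f) :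
    (evY hf ξ : ℂ) =
      ∑ i, evalAt (hf.eval_root hω i) ξ / (dehom ℂ f).derivative.eval (ω i) := by
  obtain ⟨p, rfl⟩ := AdjoinRoot.mk_surjective ξ
  have h : AdjoinRoot.mk (dehom ℚ f) p = AdjoinRoot.mk (dehom ℚ f) (p % dehom ℚ f) :=
    AdjoinRoot.mk_eq_mk.mpr (⟨p / dehom ℚ f, by
      rw [EuclideanDomain.mod_eq_sub_mul_div, sub_sub_cancel]⟩)
  rw [h]
  have hdeg := hf.natDegree_mod_le p
  simp only [evalAt_mk]
  rw [hf.sum_eval_div_derivative hω (by rw [Polynomial.natDegree_map]; omega),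
    evY_mk_of_natDegree_le hf hdeg, Polynomial.coeff_map, ← dehom_map (algebraMap ℚ ℂ),
    Polynomial.leadingCoeff_map]
  simp

lemma evX_eq_sum (hf : IsCurveForm g f) {ω : Fin (2 * g + 2) → ℂ}
    (hω : (dehom ℂ f).roots = Finset.univ.val.map ω) (ξ : Lf f) :
    (evX hf ξ : ℂ) =
      ∑ i, ω i * evalAt (hf.eval_root hω i) ξ / (dehom ℂ f).derivative.eval (ω i) := by
  rw [evX_eq_evY_root_mul, evY_eq_sum hf hω]
  simp only [map_mul, evalAt_root]

end Evaluation

/-! ### The space `M_ℚ` -/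

section Fibre

variable {f : MvPolynomial (Fin 2) ℤ} {d g : ℕ}

lemma coordToFun_mul_mem_sections (D : EffectiveDivisor f d) (c : CoordRing ℚ f)
    {h : FunField ℚ f} (hh : h ∈ D.sections) : coordToFun ℚ f c * h ∈ D.sections := by
  intro t ht
  obtain ⟨e, he⟩ := hh t ht
  exact ⟨coordToBar f c * e, by
    rw [map_mul, map_mul, funFieldToBar_coordToFun, he, mul_assoc]⟩

lemma coordToFun_mem_sections (D : EffectiveDivisor f d) (c : CoordRing ℚ f) :
    coordToFun ℚ f c ∈ D.sections := by
  have h := coordToFun_mul_mem_sections D c D.one_mem_sections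
  rwa [mul_one] at h

lemma coordToFun_z (f : MvPolynomial (Fin 2) ℤ) : coordToFun ℚ f ⟨0, 1⟩ = zFun f := by
  apply QuadraticAlgebra.ext
  · exact map_zero _
  · exact map_one _

lemma z_mul_z (f : MvPolynomial (Fin 2) ℤ) :
    (⟨0, 1⟩ * ⟨0, 1⟩ : CoordRing ℚ f) = ⟨dehom ℚ f, 0⟩ := by
  ext1 <;> simp

/-- The restriction to `S_f` of `p(X) · 1`. -/
def EffectiveDivisor.ofPoly (D : EffectiveDivisor f d) : ℚ[X] →ₗ[ℚ] D.Fibre where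
  toFun p := Submodule.Quotient.mk ⟨coordToFun ℚ f ⟨p, 0⟩, coordToFun_mem_sections D _⟩
  map_add' p q := by
    rw [← Submodule.Quotient.mk_add]
    congr 1
    apply Subtype.ext
    change coordToFun ℚ f ⟨p + q, 0⟩ = coordToFun ℚ f ⟨p, 0⟩ + coordToFun ℚ f ⟨q, 0⟩
    rw [← map_add]
    congr 1
    ext1 <;> simp
  map_smul' a p := by
    rw [RingHom.id_apply, ← Submodule.Quotient.mk_smul]
    congr 1
    apply Subtype.ext
    change coordToFun ℚ f ⟨a • p, 0⟩ = a • coordToFun ℚ f ⟨p, 0⟩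
    rw [← coordToFun_smul]
    congr 1
    ext1 <;> simp

lemma EffectiveDivisor.ofPoly_one (D : EffectiveDivisor f d) : D.ofPoly 1 = D.oneBar := by
  unfold EffectiveDivisor.oneBar EffectiveDivisor.ofPoly
  change Submodule.Quotient.mk _ = _
  congr 1
  apply Subtype.ext
  exact map_one (coordToFun ℚ f)

/-- On the curve `f(X, 1) = Z · Z`, so a multiple of `f` is `Z` times a section. -/
lemma EffectiveDivisor.ofPoly_eq_zero (D : EffectiveDivisor f d) {p : ℚ[X]}
    (h : dehom ℚ f ∣ p) : D.ofPoly p = 0 := by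
  obtain ⟨s, rfl⟩ := h
  refine (Submodule.Quotient.mk_eq_zero _).mpr ?_
  refine ⟨_, coordToFun_mem_sections D (⟨0, 1⟩ * ⟨s, 0⟩), ?_⟩
  change zFun f * coordToFun ℚ f (⟨0, 1⟩ * ⟨s, 0⟩) = coordToFun ℚ f ⟨dehom ℚ f * s, 0⟩
  rw [← coordToFun_z, ← map_mul, ← mul_assoc, z_mul_z, mk_zero_mul_mk_zero]

/-- Over `ℚ̄` the linear factors of `U(X, 1)` come from the affine points of `D`. If `f` vanished at
the `X`-coordinate of such a point, then `Z² = 0` there, which disjointness from the branch locus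
excludes. -/
lemma isCoprime_equation {U : MvPolynomial (Fin 2) ℤ} {D : EffectiveDivisor f d}
    (hD : D.DisjointFromBranch) (hU : IsEquationOf U D) : IsCoprime (dehom ℚ f) (dehom ℚ U) := by
  rw [← Polynomial.isCoprime_map (algebraMap ℚ Qbar), dehom_map, dehom_map]
  obtain ⟨c, hc0, hc⟩ := hU.vanishing
  have h : dehom Qbar U =
      Polynomial.C c * (D.aff.map fun P => Polynomial.X - Polynomial.C P.1).prod := by
    rw [dehom_eq_eval₂_map, hc]
    simp only [map_mul, map_pow, map_multiset_prod, Multiset.map_map]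
    simp [Function.comp_def]
  rw [h]
  refine IsCoprime.mul_right (isCoprime_one_right.of_isCoprime_of_dvd_right
    (Polynomial.isUnit_C.mpr (isUnit_iff_ne_zero.mpr hc0)).dvd) ?_
  refine Multiset.prod_induction (fun q => IsCoprime (dehom Qbar f) q) _
    (fun _ _ => IsCoprime.mul_right) isCoprime_one_right fun q hq => ?_
  obtain ⟨P, hP, rfl⟩ := Multiset.mem_map.mp hq
  refine ((Polynomial.irreducible_X_sub_C P.1).coprime_iff_not_dvd.mpr fun hdvd => ?_).symm
  rw [Polynomial.dvd_iff_isRoot, Polynomial.IsRoot, eval_dehom] at hdvd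
  refine hD.1 P hP (pow_eq_zero_iff two_ne_zero |>.mp ((D.aff_mem P hP).trans ?_))
  rw [MvPolynomial.aeval_def] at hdvd ⊢
  -- The structure maps `ℤ → ℚ̄` in the two evaluations are identified because ring maps out of `ℤ`
  -- are unique.
  exact (congrArg (fun φ => MvPolynomial.eval₂ φ _ f) (RingHom.ext_int _ _)).trans hdvd

/-- Write `a f + b U = 1`. For a section `h` the function `U h = p + q Z` is regular, and `f = Z²`,
so `h = b p + Z (a Z h + b q)`. The second term is `Z` times a section. -/
lemma EffectiveDivisor.ofPoly_surjective {U : MvPolynomial (Fin 2) ℤ} {D : EffectiveDivisor f d}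
    (hD : D.DisjointFromBranch) (hU : IsEquationOf U D) : Function.Surjective D.ofPoly := by
  intro v
  obtain ⟨⟨h, hh⟩, rfl⟩ := Submodule.Quotient.mk_surjective _ v
  obtain ⟨c, hc⟩ := exists_pairing hD hU hh D.one_mem_sections
  obtain ⟨a, b, hab⟩ := isCoprime_equation hD hU
  rw [star_one, mul_one] at hc
  refine ⟨b * c.re, ((Submodule.Quotient.eq _).mpr ?_).symm⟩
  refine ⟨coordToFun ℚ f (⟨a, 0⟩ * ⟨0, 1⟩) * h + coordToFun ℚ f ⟨b * c.im, 0⟩,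
    add_mem (coordToFun_mul_mem_sections D _ hh) (coordToFun_mem_sections D _), ?_⟩
  change zFun f * (coordToFun ℚ f (⟨a, 0⟩ * ⟨0, 1⟩) * h + coordToFun ℚ f ⟨b * c.im, 0⟩) =
    h - coordToFun ℚ f ⟨b * c.re, 0⟩
  have h1 : (⟨b * c.re, 0⟩ + ⟨0, 1⟩ * ⟨b * c.im, 0⟩ : CoordRing ℚ f) = ⟨b, 0⟩ * c := by
    ext1 <;> simp
  have h2 : (⟨a, 0⟩ * (⟨0, 1⟩ * ⟨0, 1⟩) + ⟨b, 0⟩ * equationFun f U : CoordRing ℚ f) = 1 := by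
    rw [z_mul_z, equationFun, mk_zero_mul_mk_zero, mk_zero_mul_mk_zero]
    ext1
    · simpa [QuadraticAlgebra.re_one] using hab
    · simp [QuadraticAlgebra.im_one]
  have h3 := congrArg (coordToFun ℚ f) h1
  have h4 := congrArg (coordToFun ℚ f) h2
  simp only [map_add, map_mul, map_one, coordToFun_z, hc] at h3 h4 ⊢
  linear_combination h3 + h * h4

lemma pairing_ofPoly {U : MvPolynomial (Fin 2) ℤ} {D : EffectiveDivisor f d}
    (hD : D.DisjointFromBranch) (hU : IsEquationOf U D) (p q : ℚ[X]) :
    pairing hD hU (D.ofPoly p) (D.ofPoly q) =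
      AdjoinRoot.mk (dehom ℚ f) (p * q * dehom ℚ U) := by
  have h : regularProduct hD hU ⟨coordToFun ℚ f ⟨p, 0⟩, coordToFun_mem_sections D _⟩
      ⟨coordToFun ℚ f ⟨q, 0⟩, coordToFun_mem_sections D _⟩ = ⟨p * q * dehom ℚ U, 0⟩ := by
    apply coordToFun_injective
    rw [coordToFun_regularProduct, ← coordToFun_star, ← map_mul, ← map_mul]
    congr 1
    have hs : star (⟨q, 0⟩ : CoordRing ℚ f) = ⟨q, 0⟩ := by ext1 <;> simp
    rw [hs, equationFun, mk_zero_mul_mk_zero, mk_zero_mul_mk_zero]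
  change restrict f (regularProduct hD hU ⟨coordToFun ℚ f ⟨p, 0⟩, coordToFun_mem_sections D _⟩
      ⟨coordToFun ℚ f ⟨q, 0⟩, coordToFun_mem_sections D _⟩) = _
  rw [h]
  rfl

/-- In terms of `L_f` this map is multiplication by `U`, a unit modulo `f`. It identifies `M_ℚ` with
`L_f`, which gives its dimension and the evaluations at roots. -/
lemma pairing_oneBar_bijective {U : MvPolynomial (Fin 2) ℤ} {D : EffectiveDivisor f d}
    (hD : D.DisjointFromBranch) (hU : IsEquationOf U D) :
    Function.Bijective (pairing hD hU D.oneBar) := by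
  obtain ⟨a, b, hab⟩ := isCoprime_equation hD hU
  rw [← D.ofPoly_one]
  constructor
  · rw [injective_iff_map_eq_zero]
    intro v hv
    obtain ⟨p, rfl⟩ := EffectiveDivisor.ofPoly_surjective hD hU v
    rw [pairing_ofPoly, one_mul, AdjoinRoot.mk_eq_zero] at hv
    exact D.ofPoly_eq_zero ((isCoprime_equation hD hU).dvd_of_dvd_mul_right hv)
  · intro ξ
    obtain ⟨p, rfl⟩ := AdjoinRoot.mk_surjective ξ
    refine ⟨D.ofPoly (p * b), ?_⟩
    rw [pairing_ofPoly, AdjoinRoot.mk_eq_mk]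
    exact ⟨-(p * a), by linear_combination p * hab⟩

lemma finite_and_finrank_fibre (hf : IsCurveForm g f) {U : MvPolynomial (Fin 2) ℤ}
    {D : EffectiveDivisor f d} (hD : D.DisjointFromBranch) (hU : IsEquationOf U D) :
    Module.Finite ℚ D.Fibre ∧ Module.finrank ℚ D.Fibre = 2 * g + 2 := by
  have hne : dehom ℚ f ≠ 0 :=
    Polynomial.ne_zero_of_natDegree_gt (n := 0) (by rw [natDegree_dehom hf]; omega)
  let e := LinearEquiv.ofBijective _ (pairing_oneBar_bijective hD hU)
  have hfin : Module.Finite ℚ (Lf f) := (AdjoinRoot.powerBasis hne).finite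
  refine ⟨Module.Finite.equiv e.symm, ?_⟩
  rw [e.finrank_eq, (AdjoinRoot.powerBasis hne).finrank, AdjoinRoot.powerBasis_dim,
    natDegree_dehom hf]

/-! ### Coordinates on `M_ℂ` from the complex points of `S_f`. -/

lemma eval_equation_ne_zero {U : MvPolynomial (Fin 2) ℤ} {D : EffectiveDivisor f d}
    (hD : D.DisjointFromBranch) (hU : IsEquationOf U D) {z : ℂ}
    (hz : (dehom ℂ f).eval z = 0) : (dehom ℂ U).eval z ≠ 0 := by
  intro h
  have hc := (isCoprime_equation hD hU).map (Polynomial.mapRingHom (algebraMap ℚ ℂ))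
  rw [Polynomial.coe_mapRingHom, dehom_map, dehom_map] at hc
  obtain ⟨a, b, hab⟩ := hc
  have := congrArg (Polynomial.eval z) hab
  simp [hz, h] at this

/-- The value of an element of `M_ℚ` at a complex point of `S_f`, with respect to the
trivialisation `1̄`. -/
def fibreEval {U : MvPolynomial (Fin 2) ℤ} {D : EffectiveDivisor f d}
    (hD : D.DisjointFromBranch) (hU : IsEquationOf U D) {z : ℂ}
    (hz : (dehom ℂ f).eval z = 0) : D.Fibre →ₗ[ℚ] ℂ :=
  (LinearMap.mulRight ℚ ((dehom ℂ U).eval z)⁻¹).comp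
    ((evalAt hz).toLinearMap.comp (pairing hD hU D.oneBar))

lemma fibreEval_ofPoly {U : MvPolynomial (Fin 2) ℤ} {D : EffectiveDivisor f d}
    (hD : D.DisjointFromBranch) (hU : IsEquationOf U D) {z : ℂ}
    (hz : (dehom ℂ f).eval z = 0) (p : ℚ[X]) :
    fibreEval hD hU hz (D.ofPoly p) = (p.map (algebraMap ℚ ℂ)).eval z := by
  change evalAt hz (pairing hD hU D.oneBar (D.ofPoly p)) * ((dehom ℂ U).eval z)⁻¹ = _
  rw [← D.ofPoly_one, pairing_ofPoly, one_mul, evalAt_mk, Polynomial.map_mul, dehom_map,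
    Polynomial.eval_mul, mul_inv_cancel_right₀ (eval_equation_ne_zero hD hU hz)]

lemma fibreEval_oneBar {U : MvPolynomial (Fin 2) ℤ} {D : EffectiveDivisor f d}
    (hD : D.DisjointFromBranch) (hU : IsEquationOf U D) {z : ℂ}
    (hz : (dehom ℂ f).eval z = 0) : fibreEval hD hU hz D.oneBar = 1 := by
  rw [← D.ofPoly_one, fibreEval_ofPoly]
  simp

lemma evalAt_pairing {U : MvPolynomial (Fin 2) ℤ} {D : EffectiveDivisor f d}
    (hD : D.DisjointFromBranch) (hU : IsEquationOf U D) {z : ℂ}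
    (hz : (dehom ℂ f).eval z = 0) (v w : D.Fibre) :
    evalAt hz (pairing hD hU v w) =
      fibreEval hD hU hz v * fibreEval hD hU hz w * (dehom ℂ U).eval z := by
  obtain ⟨p, rfl⟩ := EffectiveDivisor.ofPoly_surjective hD hU v
  obtain ⟨q, rfl⟩ := EffectiveDivisor.ofPoly_surjective hD hU w
  rw [pairing_ofPoly, evalAt_mk, fibreEval_ofPoly, fibreEval_ofPoly, Polynomial.map_mul,
    Polynomial.map_mul, dehom_map, Polynomial.eval_mul, Polynomial.eval_mul]

/-- The values of the elements of a basis of `M_ℚ` at the points of `S_f` form a nonsingular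
matrix. -/
lemma fibreEval_mulVec_injective (hf : IsCurveForm g f) {U : MvPolynomial (Fin 2) ℤ}
    {D : EffectiveDivisor f d} (hD : D.DisjointFromBranch) (hU : IsEquationOf U D)
    {ω : Fin (2 * g + 2) → ℂ} (hω : (dehom ℂ f).roots = Finset.univ.val.map ω)
    (b : Module.Basis (Fin (2 * g + 2)) ℚ D.Fibre) (x : Fin (2 * g + 2) → ℂ)
    (hx : (Matrix.of fun k i => fibreEval hD hU (hf.eval_root hω i) (b k)).mulVec x = 0) :
    x = 0 := by
  -- A kernel vector is a linear relation between the evaluations, valid on a basis and hence on all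
  -- of `M_ℚ`. Applied to `X^l · 1̄` it reads `∑ xᵢ ωᵢ^l = 0` for `l < n`, a Vandermonde system with
  -- distinct nodes.
  have h : ∑ i, (LinearMap.mulRight ℚ (x i)).comp (fibreEval hD hU (hf.eval_root hω i)) = 0 := by
    refine b.ext fun k => ?_
    rw [LinearMap.sum_apply]
    exact congrFun hx k
  refine Matrix.eq_zero_of_forall_pow_sum_mul_pow_eq_zero (hf.root_injective hω) fun l => ?_
  have h1 := LinearMap.congr_fun h (D.ofPoly (Polynomial.X ^ (l : ℕ)))
  rw [LinearMap.sum_apply] at h1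
  simpa [fibreEval_ofPoly, mul_comm] using h1

end Fibre

/-! ### The norm of `1̄` -/

section Norm

variable {f : MvPolynomial (Fin 2) ℤ} {d g : ℕ}

/-- The diagonal form of `ev_y ∘ φ`: the residue sum for `ev_y`, with `φ(v, w)` taking the value
`v(ωᵢ) w(ωᵢ) U(ωᵢ, 1)` at each root. -/
lemma formY_eq_sum (hf : IsCurveForm g f) {U : MvPolynomial (Fin 2) ℤ} {D : EffectiveDivisor f d}
    (hD : D.DisjointFromBranch) (hU : IsEquationOf U D) {ω : Fin (2 * g + 2) → ℂ}
    (hω : (dehom ℂ f).roots = Finset.univ.val.map ω) (v w : D.Fibre) :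
    (formY hf hD hU v w : ℂ) =
      ∑ i, (dehom ℂ U).eval (ω i) / (dehom ℂ f).derivative.eval (ω i) *
        fibreEval hD hU (hf.eval_root hω i) v * fibreEval hD hU (hf.eval_root hω i) w := by
  refine (evY_eq_sum hf hω (pairing hD hU v w)).trans (Finset.sum_congr rfl fun i _ => ?_)
  rw [evalAt_pairing]
  ring

lemma formX_eq_sum (hf : IsCurveForm g f) {U : MvPolynomial (Fin 2) ℤ} {D : EffectiveDivisor f d}
    (hD : D.DisjointFromBranch) (hU : IsEquationOf U D) {ω : Fin (2 * g + 2) → ℂ}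
    (hω : (dehom ℂ f).roots = Finset.univ.val.map ω) (v w : D.Fibre) :
    (formX hf hD hU v w : ℂ) =
      ∑ i, (dehom ℂ U).eval (ω i) / (dehom ℂ f).derivative.eval (ω i) * ω i *
        fibreEval hD hU (hf.eval_root hω i) v * fibreEval hD hU (hf.eval_root hω i) w := by
  refine (evX_eq_sum hf hω (pairing hD hU v w)).trans (Finset.sum_congr rfl fun i _ => ?_)
  rw [evalAt_pairing]
  ring

/-- The norm of `1̄` for the reduction covariant of a real vector space with two forms whose Gram
matrices are those of `ev_y ∘ φ` and `ev_x ∘ φ` in a rational basis of `M_ℚ`. -/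
theorem reductionCovariant_eq_rootSum (hf : IsCurveForm g f) (hg : 1 ≤ g)
    {U : MvPolynomial (Fin 2) ℤ} {D : EffectiveDivisor f (2 * g - 1)}
    (hD : D.DisjointFromBranch) (hU : IsEquationOf U D) {ω : Fin (2 * g + 2) → ℂ}
    (hω : (dehom ℂ f).roots = Finset.univ.val.map ω)
    {V : Type*} [AddCommGroup V] [Module ℝ V] (c : Module.Basis (Fin (2 * g + 2)) ℝ V)
    (b : Module.Basis (Fin (2 * g + 2)) ℚ D.Fibre) {B₁ B₂ : LinearMap.BilinForm ℝ V}
    (h₁ : ∀ k l, B₁ (c k) (c l) = formY hf hD hU (b k) (b l))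
    (h₂ : ∀ k l, B₂ (c k) (c l) = formX hf hD hU (b k) (b l)) {w : Fin (2 * g + 2) → ℚ}
    (hw : D.oneBar = ∑ k, w k • b k) :
    reductionCovariant B₁ B₂ (∑ k, (w k : ℝ) • c k) (∑ k, (w k : ℝ) • c k) =
      (rootSum f U ω : ℂ) := by
  rw [reductionCovariant_of_gram c (fibreEval_mulVec_injective hf hD hU hω b)
    (α := fun i => (dehom ℂ U).eval (ω i) / (dehom ℂ f).derivative.eval (ω i))
    (fun i => div_ne_zero (eval_equation_ne_zero hD hU (hf.eval_root hω i))
      (hf.eval_derivative_root_ne_zero hω i)) (hf.root_injective hω)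
    (fun k l => by rw [h₁, Complex.ofReal_ratCast, formY_eq_sum hf hD hU hω]; rfl)
    (fun k l => by rw [h₂, Complex.ofReal_ratCast, formX_eq_sum hf hD hU hω]; rfl),
    hf.rootSum_eq hg hU.homogeneous hω]
  congr 1
  refine Finset.sum_congr rfl fun i _ => ?_
  -- The `i`-th coordinate of the vector is the value of `1̄` at `ωᵢ`, in the trivialisation given
  -- by `1̄` itself.
  have h : ∑ k, (((w k : ℝ) : ℂ)) * fibreEval hD hU (hf.eval_root hω i) (b k) = 1 := by
    rw [← fibreEval_oneBar hD hU (hf.eval_root hω i), hw, map_sum]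
    refine Finset.sum_congr rfl fun k _ => ?_
    rw [map_smul, Rat.smul_def, Complex.ofReal_ratCast]
  simp only [Matrix.of_apply, h, norm_one, one_pow, mul_one]

end Norm

end HyperellipticReduction

end

/-! ### The two realisations of the covariant: on `M_ℝ` and on `ℝⁿ`. -/

theorem mainTheorem12 (g : ℕ) (hg : 1 ≤ g)
    -- the form `f` of degree `n = 2g + 2`
    (f : MvPolynomial (Fin 2) ℤ) (hf : IsCurveForm g f)
    -- the divisor `D` of degree `2g - 1` on `z² = f(x, y)`, disjoint from `z = 0`
    (D : EffectiveDivisor f (2 * g - 1)) (hD : D.DisjointFromBranch)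
    -- the primitive form `U` cutting out the image of `D`
    (U : MvPolynomial (Fin 2) ℤ) (hU : IsEquationOf U D)
    -- the roots of `f(X, 1)`
    (ω : Fin (2 * g + 2) → ℂ) (hω : (dehom ℂ f).roots = Finset.univ.val.map ω) :
    -- the norm of `1̄` for the reduction covariant on `M_ℝ`
    reductionCovariant (V := ℝ ⊗[ℚ] D.Fibre)
        ((formY hf hD hU).baseChange ℝ) ((formX hf hD hU).baseChange ℝ)
        (1 ⊗ₜ D.oneBar) (1 ⊗ₜ D.oneBar) = (rootSum f U ω : ℂ) ∧
    -- the same for `H_{A,B}` on `ℝⁿ`, where `(A, B)` is any pair of integral Gram matrices with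
    -- invariant form `f`, and `w ∈ ℤⁿ` is the coordinate vector of `1̄`
    ∀ (b : Module.Basis (Fin (2 * g + 2)) ℚ D.Fibre)
      (A B : Matrix (Fin (2 * g + 2)) (Fin (2 * g + 2)) ℤ) (w : Fin (2 * g + 2) → ℤ),
      (∀ i j, formY hf hD hU (b i) (b j) = A i j) →
      (∀ i j, formX hf hD hU (b i) (b j) = B i j) →
      invariantForm A B = f →
      D.oneBar = ∑ i, w i • b i →
      matrixCovariant A B (fun i => (w i : ℝ)) (fun i => (w i : ℝ)) = (rootSum f U ω : ℂ) := by 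
  refine ⟨?_, fun b A B w hA hB _ hw => ?_⟩
  · obtain ⟨hfin, hrank⟩ := finite_and_finrank_fibre hf hD hU
    -- Any rational basis will do: its real base change has the same Gram matrices, and `1̄` has the
    -- same coordinates.
    let b := Module.finBasisOfFinrankEq ℚ D.Fibre hrank
    have h := reductionCovariant_eq_rootSum hf hg hD hU hω (b.baseChange ℝ) b
      (B₁ := (formY hf hD hU).baseChange ℝ) (B₂ := (formX hf hD hU).baseChange ℝ)
      (fun k l => by
        rw [Module.Basis.baseChange_apply, Module.Basis.baseChange_apply,
          LinearMap.BilinForm.baseChange_tmul, mul_one, Rat.smul_def, mul_one])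
      (fun k l => by
        rw [Module.Basis.baseChange_apply, Module.Basis.baseChange_apply,
          LinearMap.BilinForm.baseChange_tmul, mul_one, Rat.smul_def, mul_one])
      (b.sum_repr D.oneBar).symm
    have hone : ∑ k, ((b.repr D.oneBar k : ℚ) : ℝ) • b.baseChange ℝ k = 1 ⊗ₜ D.oneBar := by
      conv_rhs => rw [← b.sum_repr D.oneBar, TensorProduct.tmul_sum]
      refine Finset.sum_congr rfl fun k _ => ?_
      rw [Module.Basis.baseChange_apply, TensorProduct.smul_tmul', ← TensorProduct.smul_tmul,
        Rat.smul_def, smul_eq_mul]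
    rwa [hone] at h
  -- The standard basis of `ℝⁿ` has Gram matrices `A`, `B`, which are those of `b` in `M_ℚ`.
  · have h := reductionCovariant_eq_rootSum hf hg hD hU hω (Pi.basisFun ℝ (Fin (2 * g + 2))) b
      (B₁ := Matrix.toBilin' (A.map (Int.cast : ℤ → ℝ)))
      (B₂ := Matrix.toBilin' (B.map (Int.cast : ℤ → ℝ)))
      (fun k l => by simp [hA, Matrix.toBilin'_single])
      (fun k l => by simp [hB, Matrix.toBilin'_single])
      (w := fun k => (w k : ℚ))
      (hw.trans (Finset.sum_congr rfl fun k _ => (Int.cast_smul_eq_zsmul ℚ _ _).symm))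
    have hv : ∑ k, ((w k : ℚ) : ℝ) • Pi.basisFun ℝ (Fin (2 * g + 2)) k = fun i => (w i : ℝ) := by
      ext i
      simp [Finset.sum_apply, Pi.single_apply]
    rwa [hv] at h
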